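/- Work with formal power series in $q$ over $\mathbb{Z}$, infinite sums and products converging coefficientwise. Write $(q)_m=\prod_{i=1}^m(1-q^i)$ and $(q)_\infty=\prod_{i\ge1}(1-q^i)$. For integers $A,B$ let $\left[{A\atop B}\right]_q=\frac{(q)_A}{(q)_B(q)_{A-B}}$ if $0\le B\le A$, and $\left[{A\atop B}\right]_q=0$ otherwise. Let $p,p'$ be coprime positive integers with $p'>p>2$, and let $r_0,s_0$ be the smallest non-negative integers with $|ps_0-p'r_0|=1$ (that is, $r_0\le r$ and $s_0\le s$ for all non-negative integers $r,s$ with $|ps-p'r|=1$). Let $$\chi^{p,p'}_{r_0,s_0}=\frac1{(q)_\infty}\sum_{\lambda=-\infty}^{\infty}\left(q^{\lambda^2pp'+\lambda(p'r_0-ps_0)}-q^{(\lambda p+r_0)(\lambda p'+s_0)}\right)$$ be the normalised Virasoro character in Rocha-Caridi form. Let $(e_0,e_1,\ldots,e_{n-1},e_n+2)$ be the continued fraction of $p'/p$, that is, $$\frac{p'}{p}=c_0+\cfrac{1}{c_1+\cfrac{1}{\ddots+\cfrac{1}{c_n}}}\qquad\text{with } c_\mu=e_\mu+2\delta_{\mu,n},$$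 with all $e_\mu\ge0$ integers and $e_\mu\ge1$ for $0<\mu<n$. Then the series defining $\chi^{p,p'}_{r_0,s_0}$ converges, and $$\chi^{p,p'}_{r_0,s_0}=\sum q^{\sum_{\mu=0}^n\sum_{i=1}^{e_\mu}\left(\lambda^{(\mu)}_i\right)^2}\,\frac1{(q)_{2\lambda^{(0)}_{e_0}}}\prod_{i=2}^{e_0}\frac1{(q)_{\lambda^{(0)}_{i-1}-\lambda^{(0)}_i}}\;\prod_{\mu=1}^{n}\prod_{i=1+\delta_{\mu,1}}^{e_\mu}\left[{2\left(w_\mu-\sum_{j=1}^i\lambda^{(\mu)}_j\right)+\lambda^{(\mu)}_{i-1}+\lambda^{(\mu)}_i\atop\lambda^{(\mu)}_{i-1}-\lambda^{(\mu)}_i}\right]_q,$$ where the sum, which converges, is over all sequences $\lambda^{(0)},\lambda^{(1)},\ldots,\lambda^{(n)}$ of partitions $\lambda^{(\mu)}=(\lambda^{(\mu)}_1\ge\cdots\ge\lambda^{(\mu)}_{e_\mu}\ge0)$ with $wt(\lambda^{(\mu)})=\sum_{i=1}^{e_\mu}\lambda^{(\mu)}_i$ such that, setting $w_\mu=\lambda^{(\mu-1)}_{e_{\mu-1}}$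 for $1\le\mu\le n$ and $\lambda^{(\mu)}_0=w_{\mu-1}-wt(\lambda^{(\mu-1)})$ for $2\le\mu\le n$: $\lambda^{(\mu)}_1\le\lambda^{(\mu)}_0$ for $1<\mu\le n$ (no condition if $e_\mu=0$); $wt(\lambda^{(\mu)})\le w_\mu$ for $0<\mu\le n$; and $wt(\lambda^{(n)})=w_n$. -/

import Mathlib

open scoped PowerSeries.WithPiTopology

noncomputable section

/-! All characters and `q`-series are formal power series in `q = PowerSeries.X` over `ℤ`;
infinite sums and products are taken in the topology of coefficientwise convergence. -/

/-- The value `c₀ + 1/(c₁ + 1/(⋯ + 1/cₙ))` of a finite continued fraction. -/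
def cfEval : (n : ℕ) → (c : ℕ → ℕ) → ℚ
  | 0, c => c 0
  | n + 1, c => c 0 + 1 / cfEval n (fun i => c (i + 1))

/-- `(c₀, c₁, …, cₙ)` is the continued fraction of `x`: `c₀ ≥ 0`, `cᵢ ≥ 1` for `0 < i < n`
and `cₙ ≥ 2`. -/
structure IsContinuedFraction (x : ℚ) (n : ℕ) (c : ℕ → ℕ) : Prop where
  value : cfEval n c = x
  one_le : ∀ i, 0 < i → i < n → 1 ≤ c i
  two_le_last : 2 ≤ c n

/-- `(q)ₘ = ∏_{i=1}^{m} (1 - q^i)`. -/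
def qPoch (m : ℕ) : PowerSeries ℤ :=
  ∏ i ∈ Finset.Icc 1 m, (1 - PowerSeries.X ^ i)

/-- `(q)_∞ = ∏_{i ≥ 1} (1 - q^i)`. -/
def qPochInf : PowerSeries ℤ :=
  ∏' i : ℕ, (1 - PowerSeries.X ^ (i + 1))

/-- The reciprocal `1 / f` of a formal power series `f` with constant coefficient `1`. -/
def qInv (f : PowerSeries ℤ) : PowerSeries ℤ :=
  PowerSeries.invOfUnit f 1

/-- The Gaussian polynomial `[A over B]_q`, which is `(q)_A / ((q)_B (q)_{A-B})` for
`0 ≤ B ≤ A` and `0` otherwise. -/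
def gaussPoly (A B : ℤ) : PowerSeries ℤ :=
  if 0 ≤ B ∧ B ≤ A then
    qPoch A.toNat * (qInv (qPoch B.toNat) * qInv (qPoch (A - B).toNat))
  else 0

/-- The term with index `l : ℤ` of the Rocha-Caridi sum,
`q^{l² p p' + l (p' r - p s)} - q^{(l p + r) (l p' + s)}`.
For `0 < r < p` and `0 < s < p'` both exponents are non-negative. -/
def rochaCaridiTerm (p p' r s : ℕ) (l : ℤ) : PowerSeries ℤ :=
  PowerSeries.X ^ (l ^ 2 * (p * p') + l * (p' * r - p * s)).toNat
    - PowerSeries.X ^ ((l * p + r) * (l * p' + s)).toNat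

/-- The (normalised) Virasoro character `χ^{p,p'}_{r,s}` in Rocha-Caridi form. -/
def virasoroChar (p p' r s : ℕ) : PowerSeries ℤ :=
  qInv qPochInf * ∑' l : ℤ, rochaCaridiTerm p p' r s l

/-! A sequence `λ⁽⁰⁾, …, λ⁽ⁿ⁾`, where `λ⁽ᵘ⁾ = (λ⁽ᵘ⁾₁, …, λ⁽ᵘ⁾_{e u})`, is encoded as a function
`lam : ℕ → ℕ → ℕ` with `lam u i = λ⁽ᵘ⁾ᵢ` for `u ≤ n` and `1 ≤ i ≤ e u`, and `lam u i = 0` for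
all other `u` and `i`. -/

/-- The weight `λ⁽ᵘ⁾₁ + ⋯ + λ⁽ᵘ⁾_{e u}` of the partition `λ⁽ᵘ⁾`. -/
def zoneWt (e : ℕ → ℕ) (lam : ℕ → ℕ → ℕ) (u : ℕ) : ℕ :=
  ∑ i ∈ Finset.Icc 1 (e u), lam u i

/-- `w_u = λ⁽ᵘ⁻¹⁾_{e (u - 1)}`; used for `u ≥ 1` only. -/
def zoneBound (e : ℕ → ℕ) (lam : ℕ → ℕ → ℕ) (u : ℕ) : ℕ :=
  lam (u - 1) (e (u - 1))

/-- `λ⁽ᵘ⁾ᵢ` extended to `i = 0` by `λ⁽ᵘ⁾₀ = w_{u-1} - wt(λ⁽ᵘ⁻¹⁾)`; the value at `i = 0` is used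
for `u ≥ 2` only. -/
def zonePart (e : ℕ → ℕ) (lam : ℕ → ℕ → ℕ) (u i : ℕ) : ℤ :=
  if i = 0 then (zoneBound e lam (u - 1) : ℤ) - (zoneWt e lam (u - 1) : ℤ) else (lam u i : ℤ)

/-- The sequences of partitions over which the fermionic sum runs. -/
structure IsFermionic (n : ℕ) (e : ℕ → ℕ) (lam : ℕ → ℕ → ℕ) : Prop where
  support : ∀ u i, ¬ (u ≤ n ∧ 1 ≤ i ∧ i ≤ e u) → lam u i = 0
  antitone : ∀ u ≤ n, ∀ i, 1 ≤ i → i + 1 ≤ e u → lam u (i + 1) ≤ lam u i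
  first_le : ∀ u ≤ n, 1 < u → zonePart e lam u 1 ≤ zonePart e lam u 0
  wt_le : ∀ u ≤ n, 0 < u → zoneWt e lam u ≤ zoneBound e lam u
  wt_last : zoneWt e lam n = zoneBound e lam n

/-- The summand of the fermionic sum. -/
def fermionicTerm (n : ℕ) (e : ℕ → ℕ) (lam : ℕ → ℕ → ℕ) : PowerSeries ℤ :=
  PowerSeries.X ^ (∑ u ∈ Finset.range (n + 1), ∑ i ∈ Finset.Icc 1 (e u), lam u i ^ 2)
    * qInv (qPoch (2 * lam 0 (e 0)))
    * (∏ i ∈ Finset.Icc 2 (e 0), qInv (qPoch (lam 0 (i - 1) - lam 0 i)))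
    * ∏ u ∈ Finset.Icc 1 n, ∏ i ∈ Finset.Icc (if u = 1 then 2 else 1) (e u),
        gaussPoly
          (2 * ((zoneBound e lam u : ℤ) - ∑ j ∈ Finset.Icc 1 i, zonePart e lam u j)
            + zonePart e lam u (i - 1) + zonePart e lam u i)
          (zonePart e lam u (i - 1) - zonePart e lam u i)

end

/-!
The proof follows the Burge tree of Foda, Lee and Welsh. To a pair of bounds `(L, M)` belongs the
kernel `B (L, M; a, b) = [M + L + a - b, L + a] [M + L - a + b, L - a]`. Bosonic sums with two
bounds arise from the Rocha-Caridi form when each of its powers of `q` is multiplied by a value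
of the kernel, at `(a, b) = (l p', l p)` for the first kind of terms and at
`(a, b) = (l p' + s, l p + r)` for the second kind (`IsBosonSum`). Two operations act on them.

* The Burge transform (`burge`), a consequence of the `q`-Saalschütz summation (`qSaalschutz`):
  `∑ i, q^{i²} [2L + M - i, 2L] B (L - i, i; a, b) = q^{b²} B (L, M; a + b, b)` if `a` and `b` do
  not have opposite signs. It turns the parameters `(p, p', r, s)` into `(p, p' + p, r, s + r)`.
* The kernel is unchanged if `L` and `M` as well as `a` and `b` are interchanged. This turns the
  parameters into `(p', p, s, r)`.

The continued fraction of `p' / p` says how to reach `(p, p', r₀, s₀)` from `(1, 2, 0, 1)` by these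
operations (`exists_realizes`). For the parameters `(1, 2, 0, 1)` the bosonic sum is `1` if `L = 0`
and `0` otherwise; this follows by one Burge transform from the parameters `(1, 1, 0, 1)`, where
the sum telescopes (`isBosonSum_one_one`). Unfolding all the transforms writes the bosonic sum as a
sum over the sizes `i` of all steps, which are the parts of the partitions `λ⁽ᵘ⁾`; the pairs
`(L, M)` that occur on the way are `(w_u - λ⁽ᵘ⁾₁ - ⋯ - λ⁽ᵘ⁾ᵢ, λ⁽ᵘ⁾ᵢ)` for `u ≥ 1`, and the final
condition `L = 0` is `wt λ⁽ⁿ⁾ = w_n` (`hasSum_fermionicTerm`).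

The character itself belongs to `L = M = ∞`. After the first step `M` is finite, and after the
first interchange `L` is; hence the kernel and the Burge transform are needed for infinite bounds
too, and there the `q`-Saalschütz summation is replaced by the Durfee rectangle identity
(`hasSum_durfee`), the Bailey lemma (`sum_qInv_mul_qInv_mul_qInv`) and the `q`-Chu-Vandermonde
summation (`qVandermonde`). All interchanges of infinite sums are harmless because a step of size
`i` contributes a multiple of `q^i` (`hasSum_prod_of_X_pow_dvd`).
-/

noncomputable section

namespace BurgeTree

open PowerSeries Finset

/-! ### Gaussian polynomials -/

theorem constantCoeff_one_sub_X_pow (i : ℕ) :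
    constantCoeff (1 - X ^ (i + 1) : PowerSeries ℤ) = 1 := by
  simp

theorem constantCoeff_qPoch (m : ℕ) : constantCoeff (qPoch m) = 1 := by
  unfold qPoch
  rw [map_prod]
  refine prod_eq_one fun i hi => ?_
  obtain ⟨j, rfl⟩ := Nat.exists_eq_add_of_le' (mem_Icc.1 hi).1
  exact constantCoeff_one_sub_X_pow j

theorem mul_qInv {f : PowerSeries ℤ} (hf : constantCoeff f = 1) : f * qInv f = 1 :=
  mul_invOfUnit f 1 (by simpa using hf)

theorem qPoch_mul_qInv (m : ℕ) : qPoch m * qInv (qPoch m) = 1 :=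
  mul_qInv (constantCoeff_qPoch m)

theorem qPoch_zero : qPoch 0 = 1 := by simp [qPoch]

theorem qPoch_succ (m : ℕ) : qPoch (m + 1) = qPoch m * (1 - X ^ (m + 1)) := by
  unfold qPoch
  rw [prod_Icc_succ_top (by omega)]

theorem qInv_qPoch_zero : qInv (qPoch 0) = 1 := by
  simpa [qPoch_zero] using qPoch_mul_qInv 0

theorem qInv_qPoch_eq (m : ℕ) :
    qInv (qPoch m) = (1 - X ^ (m + 1)) * qInv (qPoch (m + 1)) := by
  have h1 := qPoch_mul_qInv m
  have h2 := qPoch_mul_qInv (m + 1)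
  rw [qPoch_succ] at h2 ⊢
  linear_combination (-qInv (qPoch m)) * h2 +
    (1 - X ^ (m + 1)) * qInv (qPoch m * (1 - X ^ (m + 1))) * h1

/-- The Gaussian polynomial with natural arguments. -/
def qBin (n k : ℕ) : PowerSeries ℤ := gaussPoly n k

theorem gaussPoly_of_neg {A B : ℤ} (h : B < 0) : gaussPoly A B = 0 := by
  unfold gaussPoly
  rw [if_neg (by omega)]

theorem gaussPoly_of_lt {A B : ℤ} (h : A < B) : gaussPoly A B = 0 := by
  unfold gaussPoly
  rw [if_neg (by omega)]

theorem gaussPoly_symm (A B : ℤ) : gaussPoly A (A - B) = gaussPoly A B := by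
  unfold gaussPoly
  by_cases h : 0 ≤ B ∧ B ≤ A
  · rw [if_pos h, if_pos (by omega), show A - (A - B) = B by ring]
    ring
  · rw [if_neg h, if_neg (by omega)]

theorem qBin_add (k j : ℕ) :
    qBin (k + j) k = qPoch (k + j) * (qInv (qPoch k) * qInv (qPoch j)) := by
  unfold qBin gaussPoly
  rw [if_pos (by omega)]
  congr
  omega

theorem qBin_of_lt {n k : ℕ} (h : n < k) : qBin n k = 0 :=
  gaussPoly_of_lt (by exact_mod_cast h)

theorem qBin_zero_right (n : ℕ) : qBin n 0 = 1 := by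
  have := qBin_add 0 n
  rw [zero_add] at this
  rw [this, qInv_qPoch_zero, one_mul, qPoch_mul_qInv]

theorem qBin_self (n : ℕ) : qBin n n = 1 := by
  have := qBin_add n 0
  rw [add_zero] at this
  rw [this, qInv_qPoch_zero, mul_one, qPoch_mul_qInv]

/-- The `q`-Pascal rule `[n+1, k+1] = [n, k+1] + q^{n-k} [n, k]`, multiplied by `q^k` so that no
subtraction occurs and no relation between `n` and `k` is needed. -/
theorem qBin_pascal (n k : ℕ) :
    X ^ k * qBin (n + 1) (k + 1) = X ^ k * qBin n (k + 1) + X ^ n * qBin n k := by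
  rcases lt_trichotomy n k with h | rfl | h
  · rw [qBin_of_lt h, qBin_of_lt (by omega : n < k + 1), qBin_of_lt (by omega : n + 1 < k + 1)]
    simp
  · rw [qBin_self, qBin_self, qBin_of_lt (by omega : n < n + 1)]
    simp
  · obtain ⟨j, rfl⟩ := Nat.exists_eq_add_of_lt h
    have e1 := qBin_add (k + 1) (j + 1)
    have e2 := qBin_add (k + 1) j
    have e3 := qBin_add k (j + 1)
    rw [show k + 1 + (j + 1) = k + j + 1 + 1 by ring, qPoch_succ] at e1
    rw [show k + 1 + j = k + j + 1 by ring, qInv_qPoch_eq j] at e2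
    rw [show k + (j + 1) = k + j + 1 by ring, qInv_qPoch_eq k] at e3
    rw [e1, e2, e3]
    ring

/-- The other `q`-Pascal rule, in which no subtraction occurs. -/
theorem qBin_pascal' (n k : ℕ) :
    qBin (n + 1) (k + 1) = qBin n k + X ^ (k + 1) * qBin n (k + 1) := by
  rcases lt_trichotomy n k with h | rfl | h
  · rw [qBin_of_lt h, qBin_of_lt (by omega : n < k + 1), qBin_of_lt (by omega : n + 1 < k + 1)]
    simp
  · rw [qBin_self, qBin_self, qBin_of_lt (by omega : n < n + 1)]
    simp
  · obtain ⟨j, rfl⟩ := Nat.exists_eq_add_of_lt h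
    have e1 := qBin_add (k + 1) (j + 1)
    have e2 := qBin_add (k + 1) j
    have e3 := qBin_add k (j + 1)
    rw [show k + 1 + (j + 1) = k + j + 1 + 1 by ring, qPoch_succ] at e1
    rw [show k + 1 + j = k + j + 1 by ring, qInv_qPoch_eq j] at e2
    rw [show k + (j + 1) = k + j + 1 by ring, qInv_qPoch_eq k] at e3
    rw [e1, e2, e3]
    ring

/-! ### Summation formulas -/

/-- The effect of the `q`-Pascal rule for `[A + 1, k]` on the `q`-Saalschütz sum. -/
theorem qSaalschutz_split_left (A B m c : ℕ) :
    ∑ x ∈ antidiagonal (m + 1),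
    X ^ (x.1 * (x.1 + c)) * qBin (A + 1 + B + x.2) x.2 * qBin (A + 1) x.1 *
      qBin B (x.1 + c) =
    ∑ x ∈ antidiagonal (m + 1),
    X ^ (x.1 * (x.1 + c)) * qBin (A + 1 + B + x.2) x.2 * qBin A x.1 * qBin B (x.1 + c) +
    ∑ x ∈ antidiagonal m, X ^ (x.1 * (x.1 + c + 1) + c + 1 + A) *
      qBin (A + 1 + B + x.2) x.2 * qBin A x.1 * qBin B (x.1 + 1 + c) := by
  rw [Nat.sum_antidiagonal_succ, Nat.sum_antidiagonal_succ, add_assoc (_ : PowerSeries ℤ),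
    ← sum_add_distrib]
  congr 1
  · simp [qBin_zero_right]
  · refine sum_congr rfl fun x _ => ?_
    linear_combination (X ^ (x.1 * (x.1 + c + 1) + c + 1) * qBin (A + 1 + B + x.2) x.2 *
      qBin B (x.1 + 1 + c)) * qBin_pascal A x.1

/-- The effect of the `q`-Pascal rule for `[A + 1 + B + j, j]` on the `q`-Saalschütz sum. -/
theorem qSaalschutz_split_right (A B m c : ℕ) :
    ∑ x ∈ antidiagonal (m + 1),
    X ^ (x.1 * (x.1 + c)) * qBin (A + 1 + B + x.2) x.2 * qBin A x.1 * qBin B (x.1 + c) =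
    ∑ x ∈ antidiagonal (m + 1),
    X ^ (x.1 * (x.1 + c)) * qBin (A + B + x.2) x.2 * qBin A x.1 * qBin B (x.1 + c) +
    ∑ x ∈ antidiagonal m, X ^ (x.1 * (x.1 + c) + A + B + 1) *
      qBin (A + B + 1 + x.2) x.2 * qBin A x.1 * qBin B (x.1 + c) := by
  rw [Nat.sum_antidiagonal_succ', Nat.sum_antidiagonal_succ', add_assoc (_ : PowerSeries ℤ),
    ← sum_add_distrib]
  congr 1
  · simp [qBin_zero_right]
  · refine sum_congr rfl fun x _ => ?_
    have hp : qBin (A + 1 + B + (x.2 + 1)) (x.2 + 1) = qBin (A + B + (x.2 + 1)) (x.2 + 1) +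
        X ^ (A + B + 1) * qBin (A + B + 1 + x.2) x.2 := by
      have hX : (X : PowerSeries ℤ) ^ x.2 ≠ 0 := pow_ne_zero _ X_ne_zero
      apply mul_left_cancel₀ hX
      rw [show A + 1 + B + (x.2 + 1) = A + B + 1 + x.2 + 1 by ring, qBin_pascal,
        show A + B + (x.2 + 1) = A + B + 1 + x.2 by ring]
      ring
    rw [hp]
    ring

/-- The `q`-Saalschütz summation, by induction on `A`: by the `q`-Pascal rule both sides `f`
satisfy `f (A + 1, B, m + 1, c) = f (A, B, m + 1, c) + q ^ (A + 1 + c) * f (A, B + 1, m, c + 1)`. -/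
theorem qSaalschutz (A B m c : ℕ) :
    ∑ x ∈ antidiagonal m,
      X ^ (x.1 * (x.1 + c)) * qBin (A + B + x.2) x.2 * qBin A x.1 * qBin B (x.1 + c) =
    qBin (A + m + c) m * qBin (B + m) (m + c) := by
  induction A generalizing B m c with
  | zero =>
    rw [sum_eq_single_of_mem (0, m) (by simp)]
    · rcases lt_or_ge B c with h | h
      · simp [qBin_of_lt h, qBin_of_lt (by omega : B + m < m + c)]
      · obtain ⟨d, rfl⟩ := Nat.exists_eq_add_of_le h
        have e1 := qBin_add m (c + d)
        have e2 := qBin_add c d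
        have e3 := qBin_add m c
        have e4 := qBin_add (m + c) d
        rw [show m + (c + d) = c + d + m by ring] at e1
        rw [show m + c + d = c + d + m by ring] at e4
        simp only [zero_mul, pow_zero, zero_add, one_mul, qBin_zero_right, mul_one]
        rw [e1, e2, e3, e4]
        linear_combination (qPoch (c + d + m) * qInv (qPoch m) * qInv (qPoch c) *
          qInv (qPoch d)) * (qPoch_mul_qInv (c + d) - qPoch_mul_qInv (m + c))
    · rintro ⟨i, j⟩ hij hne
      rw [HasAntidiagonal.mem_antidiagonal] at hij
      have hi : 0 < i := by
        rcases Nat.eq_zero_or_pos i with rfl | h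
        · simp at hij; simp [hij] at hne
        · exact h
      simp [qBin_of_lt hi]
  | succ A ih =>
    cases m with
    | zero => simp [qBin_zero_right]
    | succ m =>
      have hA := ih B (m + 1) c
      have hB := ih (B + 1) m (c + 1)
      have hP := qBin_pascal (A + m + 1 + c) m
      have hrhs : qBin (A + 1 + (m + 1) + c) (m + 1) =
          qBin (A + (m + 1) + c) (m + 1) + X ^ (A + 1 + c) * qBin (A + m + (c + 1)) m := by
        have hX : (X : PowerSeries ℤ) ^ m ≠ 0 := pow_ne_zero _ X_ne_zero
        apply mul_left_cancel₀ hX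
        rw [show A + 1 + (m + 1) + c = A + m + 1 + c + 1 by ring, hP,
          show A + (m + 1) + c = A + m + 1 + c by ring,
          show A + m + (c + 1) = A + m + 1 + c by ring]
        ring
      rw [hrhs, add_mul, ← hA, show (X ^ (A + 1 + c) * qBin (A + m + (c + 1)) m) *
        qBin (B + (m + 1)) (m + 1 + c) = X ^ (A + 1 + c) * (qBin (A + m + (c + 1)) m *
        qBin (B + 1 + m) (m + (c + 1))) by
          rw [show B + (m + 1) = B + 1 + m by ring, show m + 1 + c = m + (c + 1) by ring]; ring,
        ← hB]
      rw [qSaalschutz_split_left, qSaalschutz_split_right, add_assoc, ← sum_add_distrib, mul_sum]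
      congr 1
      refine sum_congr rfl fun x _ => ?_
      rw [show A + (B + 1) + x.2 = A + B + 1 + x.2 by ring,
        show A + 1 + B + x.2 = A + B + 1 + x.2 by ring,
        show x.1 + (c + 1) = x.1 + c + 1 by ring, show x.1 + 1 + c = x.1 + c + 1 by ring]
      linear_combination (-X ^ (A + 1 + x.1 * (x.1 + c)) * qBin (A + B + 1 + x.2) x.2 *
        qBin A x.1) * qBin_pascal B (x.1 + c)

/-- The `q`-Chu-Vandermonde summation. The upper limit `N` is arbitrary: the terms with `k > A`
vanish. -/
theorem qVandermonde (A B c N : ℕ) (hN : A ≤ N) :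
    ∑ k ∈ range (N + 1), X ^ (k * (k + c)) * qBin A k * qBin B (k + c) =
    qBin (A + B) (A + c) := by
  induction A generalizing c N with
  | zero =>
    rw [sum_eq_single_of_mem 0 (by simp)]
    · simp [qBin_zero_right]
    · intro k _ hk
      simp [qBin_of_lt (Nat.pos_of_ne_zero hk)]
  | succ A ih =>
    obtain ⟨N, rfl⟩ : ∃ N', N = N' + 1 := ⟨N - 1, by omega⟩
    have h1 := ih c (N + 1) (by omega)
    have h2 := ih (c + 1) N (by omega)
    have hP := qBin_pascal' (A + B) (A + c)
    rw [show A + 1 + B = A + B + 1 by ring, show A + 1 + c = A + c + 1 by ring, hP, ← h1,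
      show A + c + 1 = A + (c + 1) by ring, ← h2, sum_range_succ', sum_range_succ' _ (N + 1),
      mul_sum, add_right_comm, ← sum_add_distrib]
    congr 1
    · refine sum_congr rfl fun k _ => ?_
      rw [show k + 1 + c = k + (c + 1) by ring]
      linear_combination (X ^ (k * (k + c + 1) + c + 1) * qBin B (k + (c + 1))) * qBin_pascal A k
    · simp [qBin_zero_right]

/-- The limit `A, B → ∞` of the `q`-Saalschütz summation. -/
theorem sum_qBin_mul_qInv (m c : ℕ) :
    ∑ x ∈ antidiagonal m, X ^ (x.1 * (x.1 + c)) * qBin m x.1 * qInv (qPoch (x.1 + c)) =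
    qInv (qPoch (m + c)) := by
  induction m generalizing c with
  | zero => simp [qBin_zero_right]
  | succ m ih =>
    have h1 := ih c
    have h2 := ih (c + 1)
    have e : qInv (qPoch (m + 1 + c)) = qInv (qPoch (m + c)) +
        X ^ (m + c + 1) * qInv (qPoch (m + (c + 1))) := by
      rw [qInv_qPoch_eq (m + c), show m + 1 + c = m + c + 1 by ring,
        show m + (c + 1) = m + c + 1 by ring]
      ring
    rw [e, ← h1, ← h2, mul_sum]
    have e2 : ∑ x ∈ antidiagonal m, X ^ (x.1 * (x.1 + c)) * qBin m x.1 * qInv (qPoch (x.1 + c)) =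
        ∑ x ∈ antidiagonal (m + 1),
          X ^ (x.1 * (x.1 + c)) * qBin m x.1 * qInv (qPoch (x.1 + c)) := by
      rw [Nat.sum_antidiagonal_succ']
      simp [qBin_of_lt (Nat.lt_succ_self m)]
    rw [e2, Nat.sum_antidiagonal_succ, Nat.sum_antidiagonal_succ, add_assoc (_ : PowerSeries ℤ),
      ← sum_add_distrib]
    congr 1
    · simp [qBin_zero_right]
    · refine sum_congr rfl fun x _ => ?_
      rw [show x.1 + 1 + c = x.1 + (c + 1) by ring]
      linear_combination (X ^ (x.1 * (x.1 + c + 1) + c + 1) * qInv (qPoch (x.1 + (c + 1)))) *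
        qBin_pascal m x.1

/-! ### States, steps and kernels -/

/-- A pair `(L, M)` of bounds in `ℕ ∪ {∞}`: `top` is `(∞, ∞)`, `inf M` is `(∞, M)`, `half L` is
`(L, ∞)` and `fin L M` is `(L, M)`. -/
inductive State
  | top : State
  | inf (M : ℕ) : State
  | half (L : ℕ) : State
  | fin (L M : ℕ) : State

namespace State

/-- The Burge step `(L, M) ↦ (L - i, i)`. -/
def step : State → ℕ → State
  | top, i => inf i
  | inf _, i => inf i
  | half L, i => fin (L - i) i
  | fin L _, i => fin (L - i) i

/-- The factor contributed by the Burge step `(L, M) ↦ (L - i, i)`. It vanishes unless `i ≤ L` and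
`i ≤ M`; for infinite bounds it is a limit of the value `q^{i²} [2L + M - i, M - i]` at finite
bounds, up to a factor that does not depend on `i` and is part of the kernels. -/
def weight : State → ℕ → PowerSeries ℤ
  | top, i => X ^ i ^ 2
  | inf M, i => if i ≤ M then X ^ i ^ 2 * qInv (qPoch (M - i)) else 0
  | half L, i => if i ≤ L then X ^ i ^ 2 else 0
  | fin L M, i =>
    if i ≤ L ∧ i ≤ M then X ^ i ^ 2 * gaussPoly (2 * L + M - i) (M - i) else 0

/-- The interchange of the two bounds. Its values at `top` and `half` are not compatible with the
normalisation of the kernels and play no role. -/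
def swap : State → State
  | top => top
  | inf M => half M
  | half L => inf L
  | fin L M => fin M L

/-- The factor contributed by the interchange of the two bounds, which turns the normalisation
of the kernel of `inf M` into that of the kernel of `half M`. -/
def swapWeight : State → PowerSeries ℤ
  | inf M => qInv (qPoch (2 * M))
  | _ => 1

/-- The kernel `[M + L + a - b, L + a] [M + L - a + b, L - a]` of a state `(L, M)`, which the
bosonic sums are made of, and its suitably normalised limits for infinite bounds. -/
def kernel : State → ℤ → ℤ → PowerSeries ℤ
  | top, _, _ => qInv qPochInf
  | inf M, _, b => if b.natAbs ≤ M then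
      qInv (qPoch (M - b).toNat) * qInv (qPoch (M + b).toNat) else 0
  | half L, a, _ => gaussPoly (2 * L) (L - a)
  | fin L M, a, b => gaussPoly (M + L + a - b) (L + a) * gaussPoly (M + L - a + b) (L - a)

end State

open State

theorem kernel_neg (s : State) (a b : ℤ) : s.kernel (-a) (-b) = s.kernel a b := by
  cases s with
  | top => rfl
  | inf M =>
    simp only [kernel, Int.natAbs_neg]
    split_ifs
    · rw [mul_comm, sub_neg_eq_add, ← sub_eq_add_neg]
    · rfl
  | half L =>
    simp only [kernel]
    rw [← gaussPoly_symm]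
    congr 1
    ring
  | fin L M =>
    simp only [kernel]
    rw [mul_comm]
    congr 2 <;> ring

theorem swapWeight_mul_kernel_swap_inf (M : ℕ) (a b : ℤ) :
    (inf M).swapWeight * (inf M).swap.kernel b a = (inf M).kernel a b := by
  simp only [swapWeight, swap, kernel]
  split_ifs with h
  · unfold gaussPoly
    rw [if_pos (by omega)]
    have h1 := qPoch_mul_qInv (2 * M)
    rw [show (2 * (M : ℤ) - (M - b)) = M + b by ring, show (2 * (M : ℤ)).toNat = 2 * M by omega]
    linear_combination (qInv (qPoch (M - b).toNat) * qInv (qPoch (M + b).toNat)) * h1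
  · rcases lt_or_ge (M : ℤ) b with h' | h'
    · rw [gaussPoly_of_neg (by omega), mul_zero]
    · rw [gaussPoly_of_lt (by omega), mul_zero]

theorem swapWeight_mul_kernel_swap_fin (L M : ℕ) (a b : ℤ) :
    (State.fin L M).swapWeight * (State.fin L M).swap.kernel b a =
      (State.fin L M).kernel a b := by
  simp only [swapWeight, swap, kernel]
  rw [one_mul, mul_comm, ← gaussPoly_symm _ (M - b : ℤ), ← gaussPoly_symm _ (M + b : ℤ)]
  congr 2 <;> ring

theorem gaussPoly_of_neg_left {A B : ℤ} (h : A < 0) : gaussPoly A B = 0 := by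
  unfold gaussPoly
  rw [if_neg (by omega)]

theorem gaussPoly_eq_qBin {x y : ℤ} {n k : ℕ} (hx : x = n) (hy : y = k) :
    gaussPoly x y = qBin n k := by
  rw [hx, hy, qBin]

theorem gaussPoly_eq_qBin_sub {x y : ℤ} {n k : ℕ} (hx : x = n) (hy : y = n - k) :
    gaussPoly x y = qBin n k := by
  rw [hx, hy, gaussPoly_symm, qBin]

/-- A sum over `i ≥ b` may be written as a sum over `k = i - b`. -/
theorem hasSum_of_shift {f : ℕ → PowerSeries ℤ} {F : PowerSeries ℤ} (b : ℕ)
    (h0 : ∀ i < b, f i = 0) (h : HasSum (fun k => f (b + k)) F) : HasSum f F := by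
  refine (Function.Injective.hasSum_iff (g := fun k => b + k) (add_right_injective b) ?_).1 h
  intro i hi
  apply h0
  by_contra hc
  exact hi ⟨i - b, by simp; omega⟩

/-- The kernels of the states reached from a finite state in one step, as products of `q`-binomials
in the variables of the `q`-Saalschütz and `q`-Chu-Vandermonde sums. -/
theorem kernel_step_eq {L A B a b k : ℕ} (hA : (A : ℤ) = L + a - b) (hB : (B : ℤ) = L - a + b)
    (hk : b + k ≤ L) :
    (State.fin (L - (b + k)) (b + k)).kernel a b = qBin A k * qBin B (k + 2 * b) := by
  simp only [kernel]
  congr 1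
  · exact gaussPoly_eq_qBin_sub (by omega) (by omega)
  · exact gaussPoly_eq_qBin_sub (by omega) (by omega)

theorem kernel_fin_eq_zero {L i a b : ℕ} (h : i < b) :
    (State.fin (L - i) i).kernel a b = 0 := by
  simp only [kernel]
  rw [gaussPoly_of_lt (by omega), zero_mul]

theorem kernel_fin_eq_zero_of_lt {L i a b : ℕ} (h : L + a < b ∨ L + b < a) (hi : i ≤ L) :
    (State.fin (L - i) i).kernel a b = 0 := by
  simp only [kernel]
  rcases h with h | h
  · rw [gaussPoly_of_neg_left (by omega), zero_mul]
  · rw [gaussPoly_of_neg_left (A := ((i : ℕ) : ℤ) + ((L - i : ℕ) : ℤ) - a + b) (by omega), mul_zero]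

/-- The Burge transform at finite bounds: the `q`-Saalschütz summation with `m = M - b`, `c = 2 * b`
and `k = i - b`. If `A` or `B` is negative, or if `M < b`, then both sides vanish. -/
theorem burge_fin (L M a b : ℕ) :
    HasSum (fun i => (State.fin L M).weight i * ((State.fin L M).step i).kernel a b)
      (X ^ b ^ 2 * (State.fin L M).kernel (a + b) b) := by
  simp only [weight, step]
  rcases lt_or_ge M b with hM | hM
  · convert hasSum_zero using 1
    · funext i
      split_ifs with h
      · rw [kernel_fin_eq_zero (by omega), mul_zero]
      · rw [zero_mul]
    · simp only [kernel]
      rw [gaussPoly_of_lt (by omega), zero_mul, mul_zero]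
  by_cases hab : L + a < b ∨ L + b < a
  · convert hasSum_zero using 1
    · funext i
      split_ifs with h
      · rw [kernel_fin_eq_zero_of_lt hab h.1, mul_zero]
      · rw [zero_mul]
    · simp only [kernel]
      rw [gaussPoly_of_neg (B := (L : ℤ) - (a + b)) (by omega), mul_zero, mul_zero]
  push Not at hab
  -- the `q`-binomials of the summand have the upper entries `A` and `B`, with `A + B = 2 * L`
  obtain ⟨A, hA⟩ : ∃ A : ℕ, (A : ℤ) = L + a - b := ⟨L + a - b, by omega⟩
  obtain ⟨B, hB⟩ : ∃ B : ℕ, (B : ℤ) = L - a + b := ⟨L + b - a, by omega⟩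
  obtain ⟨m, rfl⟩ := Nat.exists_eq_add_of_le hM
  refine hasSum_of_shift b ?_ ?_
  · intro i hi
    split_ifs with h
    · rw [kernel_fin_eq_zero hi, mul_zero]
    · rw [zero_mul]
  have hrhs : (State.fin L (b + m)).kernel (a + b) b =
      qBin (A + m + 2 * b) m * qBin (B + m) (m + 2 * b) := by
    simp only [kernel]
    congr 1
    · exact gaussPoly_eq_qBin_sub (by push_cast; linarith) (by push_cast; linarith)
    · exact gaussPoly_eq_qBin_sub (by push_cast; linarith) (by push_cast; linarith)
  rw [hrhs, ← qSaalschutz, Nat.sum_antidiagonal_eq_sum_range_succ_mk, mul_sum]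
  have key : ∀ k ∈ range (m + 1),
      X ^ b ^ 2 * (X ^ (k * (k + 2 * b)) * qBin (A + B + (m - k)) (m - k) * qBin A k *
        qBin B (k + 2 * b)) =
      (if b + k ≤ L ∧ b + k ≤ b + m then X ^ (b + k) ^ 2 *
        gaussPoly (2 * L + (b + m : ℕ) - (b + k : ℕ)) ((b + m : ℕ) - (b + k : ℕ)) else 0) *
        (State.fin (L - (b + k)) (b + k)).kernel a b := by
    intro k hk
    rw [mem_range] at hk
    by_cases hkL : b + k ≤ L
    · rw [if_pos ⟨hkL, by omega⟩, kernel_step_eq hA hB hkL,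
        gaussPoly_eq_qBin (n := A + B + (m - k)) (k := m - k) (by omega) (by omega)]
      ring
    · rw [if_neg (by tauto), qBin_of_lt (by omega : B < k + 2 * b)]
      simp
  rw [sum_congr rfl key]
  refine hasSum_sum_of_ne_finset_zero ?_
  intro k hk
  rw [mem_range] at hk
  rw [if_neg (by omega), zero_mul]

/-- The Burge transform for `M = ∞`: the `q`-Chu-Vandermonde summation. -/
theorem burge_half (L a b : ℕ) :
    HasSum (fun i => (half L).weight i * ((half L).step i).kernel a b)
      (X ^ b ^ 2 * (half L).kernel (a + b) b) := by
  simp only [weight, step]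
  by_cases hab : L + a < b ∨ L + b < a
  · convert hasSum_zero using 1
    · funext i
      split_ifs with h
      · rw [kernel_fin_eq_zero_of_lt hab h, mul_zero]
      · rw [zero_mul]
    · simp only [kernel]
      rw [gaussPoly_of_neg (B := (L : ℤ) - (a + b)) (by omega), mul_zero]
  push Not at hab
  -- the `q`-binomials of the summand have the upper entries `A` and `B`, with `A + B = 2 * L`
  obtain ⟨A, hA⟩ : ∃ A : ℕ, (A : ℤ) = L + a - b := ⟨L + a - b, by omega⟩
  obtain ⟨B, hB⟩ : ∃ B : ℕ, (B : ℤ) = L - a + b := ⟨L + b - a, by omega⟩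
  refine hasSum_of_shift b ?_ ?_
  · intro i hi
    split_ifs with h
    · rw [kernel_fin_eq_zero hi, mul_zero]
    · rw [zero_mul]
  have hrhs : (half L).kernel (a + b) b = qBin (A + B) (A + 2 * b) := by
    simp only [kernel]
    exact gaussPoly_eq_qBin_sub (by push_cast; linarith) (by push_cast; linarith)
  rw [hrhs, ← qVandermonde A B (2 * b) (A + L) (by omega), mul_sum]
  have key : ∀ k ∈ range (A + L + 1),
      X ^ b ^ 2 * (X ^ (k * (k + 2 * b)) * qBin A k * qBin B (k + 2 * b)) =
      (if b + k ≤ L then X ^ (b + k) ^ 2 else 0) *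
        (State.fin (L - (b + k)) (b + k)).kernel a b := by
    intro k hk
    by_cases hkL : b + k ≤ L
    · rw [if_pos hkL, kernel_step_eq hA hB hkL]
      ring
    · rw [if_neg hkL, qBin_of_lt (by omega : B < k + 2 * b)]
      simp
  rw [sum_congr rfl key]
  refine hasSum_sum_of_ne_finset_zero ?_
  intro k hk
  rw [mem_range] at hk
  rw [if_neg (by omega), zero_mul]

theorem kernel_inf_add (b m : ℕ) (a : ℤ) :
    (inf (b + m)).kernel a b = qInv (qPoch m) * qInv (qPoch (m + 2 * b)) := by
  simp only [kernel]
  rw [if_pos (by omega)]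
  congr <;> omega

theorem kernel_inf_eq_zero {M b : ℕ} (h : M < b) (a : ℤ) : (inf M).kernel a b = 0 := by
  simp only [kernel]
  rw [if_neg (by omega)]

/-- The Bailey lemma. -/
theorem sum_qInv_mul_qInv_mul_qInv (m c : ℕ) :
    ∑ k ∈ range (m + 1), X ^ (k * (k + c)) * qInv (qPoch k) * qInv (qPoch (m - k)) *
      qInv (qPoch (k + c)) = qInv (qPoch m) * qInv (qPoch (m + c)) := by
  rw [← sum_qBin_mul_qInv, Nat.sum_antidiagonal_eq_sum_range_succ_mk, mul_sum]
  refine sum_congr rfl fun k hk => ?_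
  obtain ⟨j, rfl⟩ := Nat.exists_eq_add_of_le (Nat.lt_succ_iff.1 (mem_range.1 hk))
  simp only [Nat.add_sub_cancel_left]
  rw [qBin_add]
  linear_combination (-X ^ (k * (k + c)) * qInv (qPoch k) * qInv (qPoch j) *
      qInv (qPoch (k + c))) * qPoch_mul_qInv (k + j)

/-- The Burge transform for `L = ∞`: the Bailey lemma. -/
theorem burge_inf (M a b : ℕ) :
    HasSum (fun i => (inf M).weight i * ((inf M).step i).kernel a b)
      (X ^ b ^ 2 * (inf M).kernel (a + b) b) := by
  simp only [weight, step]
  rcases lt_or_ge M b with hM | hM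
  · convert hasSum_zero using 1
    · funext i
      split_ifs with h
      · rw [kernel_inf_eq_zero (by omega), mul_zero]
      · rw [zero_mul]
    · rw [kernel_inf_eq_zero (by omega), mul_zero]
  obtain ⟨m, rfl⟩ := Nat.exists_eq_add_of_le hM
  refine hasSum_of_shift b ?_ ?_
  · intro i hi
    rw [kernel_inf_eq_zero hi, mul_zero]
  rw [kernel_inf_add, ← sum_qInv_mul_qInv_mul_qInv, mul_sum]
  have key : ∀ k ∈ range (m + 1),
      X ^ b ^ 2 * (X ^ (k * (k + 2 * b)) * qInv (qPoch k) * qInv (qPoch (m - k)) *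
        qInv (qPoch (k + 2 * b))) =
      (if b + k ≤ b + m then X ^ (b + k) ^ 2 * qInv (qPoch (b + m - (b + k))) else 0) *
        (inf (b + k)).kernel a b := by
    intro k hk
    rw [mem_range] at hk
    rw [if_pos (by omega), kernel_inf_add, Nat.add_sub_add_left]
    ring
  rw [sum_congr rfl key]
  refine hasSum_sum_of_ne_finset_zero ?_
  intro k hk
  rw [mem_range] at hk
  rw [if_neg (by omega), zero_mul]

theorem coeff_qPochInf {d m : ℕ} (h : d ≤ m) : coeff d qPochInf = coeff d (qPoch m) := by
  have h1 : Filter.Tendsto (fun n => ∏ i ∈ range n, ((1 : PowerSeries ℤ) - X ^ (i + 1)))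
      Filter.atTop (nhds qPochInf) :=
    ((WithPiTopology.multipliable_one_sub_X_pow ℤ).hasProd).tendsto_prod_nat
  have h2 := ((WithPiTopology.continuous_coeff ℤ d).tendsto _).comp h1
  refine tendsto_nhds_unique h2 (tendsto_const_nhds.congr' ?_)
  filter_upwards [Filter.eventually_ge_atTop m] with n hn
  have h3 : ∏ i ∈ range n, ((1 : PowerSeries ℤ) - X ^ (i + 1)) = qPoch n := by
    clear hn
    induction n with
    | zero => simp [qPoch_zero]
    | succ n ih => rw [prod_range_succ, ih, qPoch_succ]
  simp only [Function.comp, h3]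
  clear h3
  induction n, hn using Nat.le_induction with
  | base => rfl
  | succ n hn ih =>
    rw [qPoch_succ, mul_sub, map_sub, mul_one, ← ih, coeff_mul_X_pow', if_neg (by omega), sub_zero]

theorem constantCoeff_qPochInf : constantCoeff qPochInf = 1 := by
  rw [← coeff_zero_eq_constantCoeff_apply, coeff_qPochInf (le_refl 0), qPoch_zero]
  simp

theorem qPochInf_mul_qInv : qPochInf * qInv qPochInf = 1 := mul_qInv constantCoeff_qPochInf

/-- Reduction of power series modulo `q ^ (d + 1)`. -/
def truncHom (d : ℕ) :
    PowerSeries ℤ →+* PowerSeries ℤ ⧸ Ideal.span {(X : PowerSeries ℤ) ^ (d + 1)} :=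
  Ideal.Quotient.mk _

theorem truncHom_eq_iff {d : ℕ} {f g : PowerSeries ℤ} :
    truncHom d f = truncHom d g ↔ ∀ k ≤ d, coeff k f = coeff k g := by
  unfold truncHom
  rw [Ideal.Quotient.eq, Ideal.mem_span_singleton, X_pow_dvd_iff]
  simp only [map_sub, sub_eq_zero, Nat.lt_succ_iff]

theorem truncHom_qInv_qPoch {d m : ℕ} (h : d ≤ m) :
    truncHom d (qInv (qPoch m)) = truncHom d (qInv qPochInf) := by
  have h1 : truncHom d qPochInf = truncHom d (qPoch m) :=
    truncHom_eq_iff.2 fun k hk => coeff_qPochInf (hk.trans h)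
  have h2 := congrArg (truncHom d) qPochInf_mul_qInv
  have h3 := congrArg (truncHom d) (qPoch_mul_qInv m)
  rw [map_mul, map_one] at h2 h3
  rw [← h1] at h3
  linear_combination (truncHom d (qInv qPochInf)) * h3 - (truncHom d (qInv (qPoch m))) * h2

/-- The Durfee rectangle identity, the limit `m → ∞` of the Bailey lemma. -/
theorem hasSum_durfee (c : ℕ) :
    HasSum (fun k => X ^ (k * (k + c)) * qInv (qPoch k) * qInv (qPoch (k + c)))
      (qInv qPochInf) := by
  rw [WithPiTopology.hasSum_iff_hasSum_coeff]
  intro d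
  have hz : ∀ k, d < k → ∀ f : PowerSeries ℤ, coeff d (X ^ (k * (k + c)) * f) = 0 := by
    intro k hk f
    rw [coeff_X_pow_mul', if_neg]
    nlinarith
  have hS : truncHom d (∑ k ∈ range (d + 1), X ^ (k * (k + c)) * qInv (qPoch k) *
      qInv (qPoch (k + c))) = truncHom d (qInv qPochInf) := by
    -- a finite instance of the Bailey lemma, with bounds that are invisible modulo `q ^ (d + 1)`
    have h1 := congrArg (truncHom d) (sum_qInv_mul_qInv_mul_qInv (2 * d) c)
    rw [map_sum, map_mul, truncHom_qInv_qPoch (by omega), truncHom_qInv_qPoch (by omega)] at h1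
    have h2 : ∑ k ∈ range (2 * d + 1), truncHom d (X ^ (k * (k + c)) * qInv (qPoch k) *
        qInv (qPoch (2 * d - k)) * qInv (qPoch (k + c))) = truncHom d (qInv qPochInf) *
        truncHom d (∑ k ∈ range (d + 1), X ^ (k * (k + c)) * qInv (qPoch k) *
          qInv (qPoch (k + c))) := by
      rw [map_sum, mul_sum]
      symm
      refine sum_subset_zero_on_sdiff (range_mono (by omega)) ?_ ?_
      · intro k hk
        rw [mem_sdiff, mem_range, mem_range] at hk
        rw [← map_zero (truncHom d), truncHom_eq_iff]
        intro j hj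
        rw [mul_assoc, mul_assoc, coeff_X_pow_mul', if_neg, map_zero]
        have : d < k := by omega
        nlinarith
      · intro k hk
        rw [mem_range] at hk
        simp only [map_mul]
        rw [truncHom_qInv_qPoch (m := 2 * d - k) (by omega)]
        ring
    rw [h2] at h1
    have h3 := congrArg (truncHom d) qPochInf_mul_qInv
    rw [map_mul, map_one] at h3
    linear_combination (truncHom d qPochInf) * h1 - (truncHom d (∑ k ∈ range (d + 1),
      X ^ (k * (k + c)) * qInv (qPoch k) * qInv (qPoch (k + c))) - truncHom d (qInv qPochInf)) * h3
  rw [← truncHom_eq_iff.1 hS d le_rfl, map_sum]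
  refine hasSum_sum_of_ne_finset_zero ?_
  intro k hk
  rw [mem_range] at hk
  rw [mul_assoc]
  exact hz k (by omega) _

/-- The Burge transform for `L = M = ∞`: the Durfee rectangle identity. -/
theorem burge_top (a b : ℕ) :
    HasSum (fun i => top.weight i * (top.step i).kernel a b)
      (X ^ b ^ 2 * top.kernel (a + b) b) := by
  simp only [weight, step]
  refine hasSum_of_shift b ?_ ?_
  · intro i hi
    rw [kernel_inf_eq_zero hi, mul_zero]
  refine ((hasSum_durfee (2 * b)).mul_left (X ^ b ^ 2)).congr_fun fun k => ?_
  rw [kernel_inf_add]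
  ring

/-- The Burge transform: a step changes the kernel at `(a, b)` into the kernel at `(a + b, b)`,
provided that `a` and `b` do not have opposite signs. -/
theorem burge (s : State) {a b : ℤ} (h : 0 ≤ a ∧ 0 ≤ b ∨ a ≤ 0 ∧ b ≤ 0) :
    HasSum (fun i => s.weight i * (s.step i).kernel a b)
      (X ^ b.natAbs ^ 2 * s.kernel (a + b) b) := by
  have hnat : ∀ a b : ℕ, HasSum (fun i => s.weight i * (s.step i).kernel a b)
      (X ^ b ^ 2 * s.kernel (a + b) b) := by
    intro a b
    cases s with
    | top => exact burge_top a b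
    | inf M => exact burge_inf M a b
    | half L => exact burge_half L a b
    | fin L M => exact burge_fin L M a b
  rcases h with ⟨ha, hb⟩ | ⟨ha, hb⟩
  · obtain ⟨a, rfl⟩ := Int.eq_ofNat_of_zero_le ha
    obtain ⟨b, rfl⟩ := Int.eq_ofNat_of_zero_le hb
    exact hnat a b
  · obtain ⟨a', ha'⟩ := Int.eq_ofNat_of_zero_le (neg_nonneg.2 ha)
    obtain ⟨b', hb'⟩ := Int.eq_ofNat_of_zero_le (neg_nonneg.2 hb)
    have hk := hnat a' b'
    rw [← ha', ← hb'] at hk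
    simp only [kernel_neg, ← neg_add] at hk
    rwa [show b.natAbs = b' by omega]

theorem X_pow_dvd_weight (s : State) (i : ℕ) : X ^ i ∣ s.weight i := by
  have h : (X : PowerSeries ℤ) ^ i ∣ X ^ i ^ 2 := pow_dvd_pow _ (Nat.le_self_pow two_ne_zero i)
  cases s <;> simp only [weight]
  · exact h
  all_goals split_ifs
  all_goals first | exact h | exact dvd_zero _ | exact h.mul_right _

/-! ### Double sums of power series -/

theorem coeff_eq_zero_of_X_pow_dvd {d i : ℕ} {f : PowerSeries ℤ} (h : X ^ i ∣ f) (hd : d < i) :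
    coeff d f = 0 :=
  X_pow_dvd_iff.1 h d hd

theorem summable_of_X_pow_dvd {g : ℕ → PowerSeries ℤ} (h : ∀ i, X ^ i ∣ g i) : Summable g := by
  rw [WithPiTopology.summable_iff_summable_coeff]
  intro d
  refine summable_of_ne_finset_zero (s := range (d + 1)) fun i hi => ?_
  rw [mem_range] at hi
  exact coeff_eq_zero_of_X_pow_dvd (h i) (by omega)

/-- An iterated sum is a double sum if the outer index bounds the order of the terms from below. -/
theorem hasSum_prod_of_X_pow_dvd {Z : Type*} {f : ℕ × Z → PowerSeries ℤ} {g : ℕ → PowerSeries ℤ}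
    {T : PowerSeries ℤ} (hd : ∀ p, X ^ p.1 ∣ f p) (hf : ∀ i, HasSum (fun z => f (i, z)) (g i))
    (hg : HasSum g T) : HasSum f T := by
  rw [WithPiTopology.hasSum_iff_hasSum_coeff] at hg ⊢
  intro d
  have hf' : ∀ i, HasSum (fun z => coeff d (f (i, z))) (coeff d (g i)) := fun i =>
    (WithPiTopology.hasSum_iff_hasSum_coeff ℤ).1 (hf i) d
  have hT : coeff d T = ∑ i ∈ range (d + 1), coeff d (g i) := by
    refine (hg d).unique (hasSum_sum_of_ne_finset_zero fun i hi => ?_)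
    rw [mem_range] at hi
    refine (hf' i).unique ?_
    convert hasSum_zero using 1
    funext z
    exact coeff_eq_zero_of_X_pow_dvd (hd (i, z)) (by simp; omega)
  rw [hT]
  have h1 : ∀ i ∈ range (d + 1), HasSum (fun p : ℕ × Z => if p.1 = i then coeff d (f p) else 0)
      (coeff d (g i)) := by
    intro i _
    refine (Function.Injective.hasSum_iff (g := fun z : Z => (i, z)) (Prod.mk_right_injective i)
      ?_).1 ?_
    · rintro ⟨j, z⟩ hj
      rw [if_neg]
      rintro rfl
      exact hj ⟨z, rfl⟩
    · simpa [Function.comp_def] using hf' i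
  refine (hasSum_sum h1).congr_fun fun p => ?_
  rw [sum_ite_eq]
  split_ifs with h
  · rfl
  · rw [mem_range] at h
    exact coeff_eq_zero_of_X_pow_dvd (hd p) (by omega)

theorem hasSum_swap {Z : Type*} {f : ℕ × Z → PowerSeries ℤ} {g : Z → PowerSeries ℤ}
    {T : PowerSeries ℤ} (hf : HasSum f T) (hg : ∀ z, HasSum (fun i => f (i, z)) (g z)) :
    HasSum g T := by
  have h1 : HasSum (f ∘ Equiv.prodComm Z ℕ) T := (Equiv.hasSum_iff _).2 hf
  exact h1.prod_fiberwise hg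

/-! ### Bosonic sums -/

/-- The exponent of the first term in the Rocha-Caridi form. -/
def exponent₁ (p p' r s : ℕ) (l : ℤ) : ℕ := (l ^ 2 * (p * p') + l * (p' * r - p * s)).toNat

/-- The exponent of the second term in the Rocha-Caridi form. -/
def exponent₂ (p p' r s : ℕ) (l : ℤ) : ℕ := ((l * p + r) * (l * p' + s)).toNat

/-- `F` is the bosonic sum with parameters `(p, p', r, s)` that is made of the values of `K`. The
two kinds of terms are summed separately, so that they can be reindexed separately. -/
def IsBosonSum (p p' r s : ℕ) (K : ℤ → ℤ → PowerSeries ℤ) (F : PowerSeries ℤ) : Prop :=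
  ∃ A B : PowerSeries ℤ,
    HasSum (fun l : ℤ => X ^ exponent₁ p p' r s l * K (l * p') (l * p)) A ∧
    HasSum (fun l : ℤ => X ^ exponent₂ p p' r s l * K (l * p' + s) (l * p + r)) B ∧ F = A - B

/-- The Burge transform of a family of sums of kernels: the sum over `i` may be performed inside. -/
theorem hasSum_kernel_of_hasSum_step (σ : State) {Λ : Type*} {E : Λ → ℕ} {a b : Λ → ℤ}
    (hab : ∀ l, 0 ≤ a l ∧ 0 ≤ b l ∨ a l ≤ 0 ∧ b l ≤ 0) {F : ℕ → PowerSeries ℤ}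
    (hF : ∀ i, HasSum (fun l => X ^ E l * (σ.step i).kernel (a l) (b l)) (F i))
    {T : PowerSeries ℤ} (hT : HasSum (fun i => σ.weight i * F i) T) :
    HasSum (fun l => X ^ (E l + (b l).natAbs ^ 2) * σ.kernel (a l + b l) (b l)) T := by
  have h1 : HasSum (fun p : ℕ × Λ =>
      σ.weight p.1 * (X ^ E p.2 * (σ.step p.1).kernel (a p.2) (b p.2))) T :=
    hasSum_prod_of_X_pow_dvd (fun p => Dvd.dvd.mul_right (X_pow_dvd_weight σ p.1)
      (X ^ E p.2 * (σ.step p.1).kernel (a p.2) (b p.2)))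
      (fun i => (hF i).mul_left (σ.weight i)) hT
  refine hasSum_swap h1 fun l => ?_
  have h2 := (burge σ (hab l)).mul_left (X ^ E l)
  rw [← mul_assoc, ← pow_add] at h2
  refine h2.congr_fun fun i => ?_
  ring

/-- The conditions on the parameters under which the Burge transform applies. -/
structure IsAdmissible (p p' r s : ℕ) : Prop where
  p_pos : 0 < p
  p'_pos : 0 < p'
  abs_eq_one : |(p : ℤ) * s - p' * r| = 1
  r_le : r ≤ p
  s_le : s ≤ p'

theorem IsAdmissible.exponent₁_nonneg {p p' r s : ℕ} (h : IsAdmissible p p' r s) (l : ℤ) :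
    0 ≤ l ^ 2 * ((p : ℤ) * p') + l * (p' * r - p * s) := by
  have h1 : (1 : ℤ) ≤ (p : ℤ) * p' := by exact_mod_cast Nat.mul_pos h.p_pos h.p'_pos
  have h2 : l ^ 2 ≤ l ^ 2 * ((p : ℤ) * p') := le_mul_of_one_le_right (sq_nonneg l) h1
  have h3 : |l| ≤ l ^ 2 := by
    rw [← sq_abs]
    rcases eq_or_ne l 0 with rfl | hl
    · simp
    · nlinarith [abs_pos.2 hl, abs_nonneg l, Int.one_le_abs hl]
  rcases (abs_eq zero_le_one).1 h.abs_eq_one with h4 | h4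
  · rw [show (p' : ℤ) * r - p * s = -1 by linarith]
    linarith [le_abs_self l]
  · rw [show (p' : ℤ) * r - p * s = 1 by linarith]
    linarith [neg_abs_le l]

/-- The kernel is evaluated at pairs of integers that do not have opposite signs. -/
theorem same_sign (p p' r s : ℕ) (hr : r ≤ p) (hs : s ≤ p') (l : ℤ) :
    0 ≤ l * p' + s ∧ 0 ≤ l * p + r ∨ l * p' + s ≤ 0 ∧ l * p + r ≤ 0 := by
  rcases le_or_gt 0 l with h | h
  · left
    constructor <;> positivity
  · right
    have hr' : (r : ℤ) ≤ p := by exact_mod_cast hr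
    have hs' : (s : ℤ) ≤ p' := by exact_mod_cast hs
    constructor <;> nlinarith

theorem exponent₁_step {p p' r s : ℕ} (h : IsAdmissible p p' r s) (l : ℤ) :
    exponent₁ p (p' + p) r (s + r) l = exponent₁ p p' r s l + (l * p).natAbs ^ 2 := by
  unfold exponent₁
  zify
  rw [Int.toNat_of_nonneg (h.exponent₁_nonneg l), sq_abs, Int.toNat_of_nonneg]
  · ring
  · nlinarith [h.exponent₁_nonneg l, sq_nonneg (l * p)]

theorem exponent₂_step {p p' r s : ℕ} (h : IsAdmissible p p' r s) (l : ℤ) :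
    exponent₂ p (p' + p) r (s + r) l = exponent₂ p p' r s l + (l * p + r).natAbs ^ 2 := by
  have h0 : 0 ≤ (l * p + r) * (l * p' + s) := by
    rcases same_sign p p' r s h.r_le h.s_le l with h1 | h1
    · exact mul_nonneg h1.2 h1.1
    · exact mul_nonneg_of_nonpos_of_nonpos h1.2 h1.1
  unfold exponent₂
  zify
  rw [Int.toNat_of_nonneg h0, sq_abs, Int.toNat_of_nonneg]
  · ring
  · nlinarith [sq_nonneg (l * p + r)]

/-- The Burge transform of a bosonic sum. -/
theorem IsBosonSum.step {p p' r s : ℕ} (h : IsAdmissible p p' r s) (σ : State)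
    {F : ℕ → PowerSeries ℤ} (hF : ∀ i, IsBosonSum p p' r s (σ.step i).kernel (F i))
    {T : PowerSeries ℤ} (hT : HasSum (fun i => σ.weight i * F i) T) :
    IsBosonSum p (p' + p) r (s + r) σ.kernel T := by
  choose A B hA hB hAB using hF
  have hsum : ∀ G : ℕ → PowerSeries ℤ, Summable (fun i => σ.weight i * G i) := fun G =>
    summable_of_X_pow_dvd fun i => (X_pow_dvd_weight σ i).mul_right _
  refine ⟨∑' i, σ.weight i * A i, ∑' i, σ.weight i * B i, ?_, ?_, hT.unique ?_⟩
  rotate_left 2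
  · simp only [hAB, mul_sub]
    exact (hsum A).hasSum.sub (hsum B).hasSum
  · refine (hasSum_kernel_of_hasSum_step σ ?_ hA (hsum A).hasSum).congr_fun fun l => ?_
    · intro l
      simpa using same_sign p p' 0 0 (Nat.zero_le _) (Nat.zero_le _) l
    · rw [exponent₁_step h]
      push_cast
      rw [mul_add]
  · refine (hasSum_kernel_of_hasSum_step σ ?_ hB (hsum B).hasSum).congr_fun fun l => ?_
    · exact same_sign p p' r s h.r_le h.s_le
    · rw [exponent₂_step h]
      push_cast
      congr 2
      ring

/-- The interchange of the bounds in a bosonic sum. -/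
theorem IsBosonSum.swap {p p' r s : ℕ} {K K' : ℤ → ℤ → PowerSeries ℤ} {c F : PowerSeries ℤ}
    (hF : IsBosonSum p p' r s K F) (hK : ∀ a b, c * K b a = K' a b)
    (hneg : ∀ a b, K (-a) (-b) = K a b) :
    IsBosonSum p' p s r K' (c * F) := by
  obtain ⟨A, B, hA, hB, rfl⟩ := hF
  refine ⟨c * A, c * B, ?_, ?_, mul_sub _ _ _⟩
  · -- the linear part of the exponent changes its sign, which is made up for by `l ↦ -l`
    have h1 := ((Equiv.neg ℤ).hasSum_iff.2 hA).mul_left c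
    refine h1.congr_fun fun l => ?_
    simp only [Function.comp, Equiv.neg_apply, neg_mul, hneg, ← hK]
    rw [show exponent₁ p p' r s (-l) = exponent₁ p' p s r l by unfold exponent₁; congr 1; ring]
    ring
  · refine (hB.mul_left c).congr_fun fun l => ?_
    rw [← hK, show exponent₂ p p' r s l = exponent₂ p' p s r l by
      unfold exponent₂; congr 1; ring]
    ring

/-! ### The initial bosonic sum -/

/-- The `q`-Pascal rule for an arbitrary integer as lower entry. The exponent may be truncated only
where the Gaussian polynomial that it belongs to vanishes. -/
theorem gaussPoly_pascal (N : ℕ) (k : ℤ) :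
    gaussPoly (N + 1) k = gaussPoly N k + X ^ (N + 1 - k).toNat * gaussPoly N (k - 1) := by
  rcases lt_trichotomy k 0 with hk | rfl | hk
  · rw [gaussPoly_of_neg hk, gaussPoly_of_neg hk, gaussPoly_of_neg (by omega)]
    simp
  · have h1 := qBin_zero_right N
    have h2 := qBin_zero_right (N + 1)
    unfold qBin at h1 h2
    push_cast at h1 h2
    rw [h1, h2, gaussPoly_of_neg (by omega)]
    simp
  · obtain ⟨k, rfl⟩ : ∃ j : ℕ, k = j + 1 := ⟨(k - 1).toNat, by omega⟩
    rcases lt_or_ge N k with h | h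
    · rw [gaussPoly_of_lt (by omega), gaussPoly_of_lt (by omega), gaussPoly_of_lt (by omega)]
      simp
    · have hX : (X : PowerSeries ℤ) ^ k ≠ 0 := pow_ne_zero _ X_ne_zero
      apply mul_left_cancel₀ hX
      have h1 := qBin_pascal N k
      unfold qBin at h1
      push_cast at h1
      rw [h1, mul_add, ← mul_assoc, ← pow_add, add_sub_cancel_right]
      congr 3
      omega

theorem tsum_eq_tsum_of_telescoping {f g H : ℤ → PowerSeries ℤ} (sf : Summable f)
    (sg : Summable g) (sH : Summable H) (h : ∀ l, f l - g (l - 1) = H l - H (l - 1)) :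
    ∑' l, f l = ∑' l, g l := by
  have h1 : HasSum (fun l => f l - g (l - 1)) (∑' l, f l - ∑' l, g l) :=
    sf.hasSum.sub ((Equiv.subRight (1 : ℤ)).hasSum_iff.2 sg.hasSum)
  have h2 : HasSum (fun l => H l - H (l - 1)) (∑' l, H l - ∑' l, H l) :=
    sH.hasSum.sub ((Equiv.subRight (1 : ℤ)).hasSum_iff.2 sH.hasSum)
  simp only [h] at h1
  rw [← sub_eq_zero, h1.unique h2, sub_self]

/-- The two kinds of terms of the bosonic sum with parameters `(1, 1, 0, 1)` differ by a telescoping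
sum. -/
theorem isBosonSum_one_one (L M : ℕ) :
    IsBosonSum 1 1 0 1 (State.fin L M).kernel (if L = 0 ∧ M = 0 then 1 else 0) := by
  simp only [IsBosonSum, kernel, exponent₁, exponent₂]
  push_cast
  simp only [mul_one, add_zero]
  by_cases h : L = 0 ∧ M = 0
  · obtain ⟨rfl, rfl⟩ := h
    refine ⟨1, 0, ?_, ?_, by simp⟩
    · convert hasSum_single (0 : ℤ) ?_ using 1
      · have := qBin_zero_right 0
        unfold qBin at this
        simp at this
        simp [this]
      · intro l hl
        rcases lt_or_gt_of_ne hl with h | h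
        · rw [gaussPoly_of_neg (by push_cast; omega), zero_mul, mul_zero]
        · rw [gaussPoly_of_lt (B := ((0 : ℕ) : ℤ) + l) (by push_cast; omega), zero_mul, mul_zero]
    · convert hasSum_zero using 1
      funext l
      rw [gaussPoly_of_neg_left (A := ((0 : ℕ) : ℤ) + ((0 : ℕ) : ℤ) - (l + 1) + l)
        (by push_cast; omega), mul_zero, mul_zero]
  · rw [if_neg h]
    obtain ⟨N, hN⟩ : ∃ N, M + L = N + 1 := ⟨M + L - 1, by omega⟩
    set H : ℤ → PowerSeries ℤ := fun l =>
      X ^ (M + l ^ 2).toNat * (gaussPoly (N + 1) (L + l) * gaussPoly N (L - l - 1)) with hH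
    set f : ℤ → PowerSeries ℤ := fun l => X ^ (l ^ 2 + l * -1).toNat *
      (gaussPoly (M + L + l - l) (L + l) * gaussPoly (M + L - l + l) (L - l)) with hf
    set g : ℤ → PowerSeries ℤ := fun l => X ^ (l * (l + 1)).toNat *
      (gaussPoly (M + L + (l + 1) - l) (L + (l + 1)) *
        gaussPoly (M + L - (l + 1) + l) (L - (l + 1))) with hg
    have supp : ∀ {x y z w : ℤ → ℤ} {c : ℤ → PowerSeries ℤ} (m : ℤ),
        (∀ l, l < -m → y l < 0 ∨ w l < 0) → (∀ l, m < l → y l < 0 ∨ w l < 0) →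
        Summable (fun l => c l * (gaussPoly (x l) (y l) * gaussPoly (z l) (w l))) := by
      intro x y z w c m h1 h2
      refine summable_of_ne_finset_zero (s := Icc (-m) m) fun l hl => ?_
      have : y l < 0 ∨ w l < 0 := by
        rcases lt_or_ge l (-m) with h | h
        · exact h1 l h
        · exact h2 l (by rw [mem_Icc] at hl; omega)
      rcases this with h | h
      · rw [gaussPoly_of_neg h, zero_mul, mul_zero]
      · rw [gaussPoly_of_neg h, mul_zero, mul_zero]
    have sH : Summable H := supp (L + 1) (by intros; omega) (by intros; omega)
    have sf : Summable f := supp (L + 1) (by intros; omega) (by intros; omega)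
    have sg : Summable g := supp (L + 1) (by intros; omega) (by intros; omega)
    have tele : ∀ l, f l - g (l - 1) = H l - H (l - 1) := by
      intro l
      have hNM : (M : ℤ) + L = N + 1 := by exact_mod_cast hN
      have e1 := gaussPoly_pascal (N + 1) (L + l)
      have e2 := gaussPoly_pascal N (L - l)
      simp only [hf, hg, hH]
      rw [show (M : ℤ) + L + l - l = N + 1 by linarith,
        show (M : ℤ) + L - l + l = N + 1 by linarith,
        show (M : ℤ) + L + (l - 1 + 1) - (l - 1) = (N + 1 : ℕ) + 1 by push_cast; linarith,
        show (M : ℤ) + L - (l - 1 + 1) + (l - 1) = N by linarith,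
        show (L : ℤ) + (l - 1 + 1) = L + l by ring, show (L : ℤ) - (l - 1 + 1) = L - l by ring,
        show (L : ℤ) + (l - 1) = L + l - 1 by ring, show (L : ℤ) - (l - 1) - 1 = L - l by ring,
        e1, e2]
      push_cast
      have hl : 0 ≤ l ^ 2 + l * -1 := by
        rcases le_or_gt l 0 with h | h <;> nlinarith
      have key1 : X ^ (l ^ 2 + l * -1).toNat *
          (X ^ ((N : ℤ) + 1 - (L - l)).toNat * (gaussPoly (N + 1) (L + l) *
            gaussPoly N (L - l - 1))) =
          X ^ (M + l ^ 2).toNat * (gaussPoly (N + 1) (L + l) * gaussPoly N (L - l - 1)) := by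
        by_cases h'' : 0 ≤ (M : ℤ) + l
        · rw [← mul_assoc, ← pow_add]
          congr 2
          zify
          rw [Int.toNat_of_nonneg hl, Int.toNat_of_nonneg (by omega),
            Int.toNat_of_nonneg (by positivity)]
          linarith
        · rw [gaussPoly_of_lt (A := (N : ℤ)) (B := L - l - 1) (by omega)]
          simp
      have key2 : ∀ Z : PowerSeries ℤ, X ^ (l ^ 2 + l * -1).toNat *
          (X ^ ((N : ℤ) + 1 + 1 - (L + l)).toNat * (gaussPoly (N + 1) (L + l - 1) * Z)) =
          X ^ (M + (l - 1) ^ 2).toNat * (gaussPoly (N + 1) (L + l - 1) * Z) := by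
        intro Z
        rcases lt_or_ge ((N : ℤ) + 1) (L + l - 1) with h' | h'
        · rw [gaussPoly_of_lt h']
          simp
        rw [← mul_assoc, ← pow_add]
        congr 2
        zify
        rw [Int.toNat_of_nonneg hl, Int.toNat_of_nonneg (by omega),
          Int.toNat_of_nonneg (by positivity)]
        linarith
      rw [show (l - 1) * (l - 1 + 1) = l ^ 2 + l * -1 by ring]
      linear_combination key1 - key2 (gaussPoly N (L - l))
    refine ⟨_, _, sf.hasSum, sg.hasSum, ?_⟩
    rw [tsum_eq_tsum_of_telescoping sf sg sH tele, sub_self]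

/-- The Burge transform of the preceding sum; only the term with `i = 0 = L` is left. -/
theorem isBosonSum_one_two (L M : ℕ) :
    IsBosonSum 1 2 0 1 (State.fin L M).kernel (if L = 0 then 1 else 0) := by
  refine IsBosonSum.step (p := 1) (p' := 1) (r := 0) (s := 1)
    ⟨one_pos, one_pos, by norm_num, zero_le_one, le_rfl⟩ (State.fin L M)
    (fun i => isBosonSum_one_one (L - i) i) ?_
  convert hasSum_single 0 ?_ using 1
  · by_cases hL : L = 0
    · subst hL
      have := qBin_self M
      unfold qBin at this
      simpa [weight] using this.symm
    · simp [hL]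
  · intro i hi
    simp [hi]

/-! ### Fermionic sums over paths of states -/

/-- The two ways to pass from one state to another. -/
inductive Move
  | step : Move
  | swap : Move

/-- The value `1` at the final states `(0, M)`, and `0` at all others. -/
def finalWeight : State → PowerSeries ℤ
  | State.fin 0 _ => 1
  | _ => 0

/-- The contribution of the path which starts at the state `σ` and performs the moves of a word,
where the sizes of the steps are the entries of a list; it is `0` if the length of the list is not
the number of steps in the word. -/
def pathWeight : List Move → State → List ℕ → PowerSeries ℤ
  | [], σ, [] => finalWeight σ
  | [], _, _ :: _ => 0
  | Move.step :: _, _, [] => 0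
  | Move.step :: w, σ, i :: x => σ.weight i * pathWeight w (σ.step i) x
  | Move.swap :: w, σ, x => σ.swapWeight * pathWeight w σ.swap x

/-- The sum over all paths that start at `σ` and follow the word `w` equals the bosonic sum with
parameters `(p, p', r, s)` at `σ`. -/
def Realizes (w : List Move) (p p' r s : ℕ) (σ : State) : Prop :=
  ∃ F : PowerSeries ℤ, HasSum (pathWeight w σ) F ∧ IsBosonSum p p' r s σ.kernel F

theorem Realizes.step {w : List Move} {p p' r s : ℕ} (h : IsAdmissible p p' r s) {σ : State}
    (hw : ∀ i, Realizes w p p' r s (σ.step i)) :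
    Realizes (Move.step :: w) p (p' + p) r (s + r) σ := by
  choose F hF hB using hw
  have hs : Summable (fun i => σ.weight i * F i) :=
    summable_of_X_pow_dvd fun i => (X_pow_dvd_weight σ i).mul_right _
  refine ⟨_, ?_, IsBosonSum.step h σ hB hs.hasSum⟩
  have h1 : HasSum (fun p : ℕ × List ℕ => σ.weight p.1 * pathWeight w (σ.step p.1) p.2)
      (∑' i, σ.weight i * F i) :=
    hasSum_prod_of_X_pow_dvd (fun p => Dvd.dvd.mul_right (X_pow_dvd_weight σ p.1)
      (pathWeight w (σ.step p.1) p.2)) (fun i => (hF i).mul_left (σ.weight i)) hs.hasSum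
  have hinj : Function.Injective (fun p : ℕ × List ℕ => p.1 :: p.2) := by
    rintro ⟨i, x⟩ ⟨j, y⟩ hxy
    simpa using hxy
  refine (hinj.hasSum_iff ?_).1 h1
  rintro (_ | ⟨i, x⟩) hx
  · rfl
  · exact absurd ⟨(i, x), rfl⟩ hx

theorem Realizes.swap {w : List Move} {p p' r s : ℕ} {σ : State}
    (hσ : ∀ a b, σ.swapWeight * σ.swap.kernel b a = σ.kernel a b)
    (hw : Realizes w p p' r s σ.swap) : Realizes (Move.swap :: w) p' p s r σ := by
  obtain ⟨F, hF, hB⟩ := hw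
  refine ⟨σ.swapWeight * F, ?_, hB.swap hσ (kernel_neg _)⟩
  refine (hF.mul_left σ.swapWeight).congr_fun fun x => ?_
  cases x <;> rfl

theorem realizes_nil (L M : ℕ) : Realizes [] 1 2 0 1 (State.fin L M) := by
  refine ⟨_, ?_, isBosonSum_one_two L M⟩
  convert hasSum_single ([] : List ℕ) ?_ using 1
  · cases L <;> rfl
  · rintro (_ | ⟨i, x⟩) hx
    · exact absurd rfl hx
    · rfl

/-- The parameters `(r, s)` of minimal size with `|p s - p' r| = 1`. These conditions are preserved
by the Burge transform and by the interchange of the bounds. -/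
structure IsMinimal (p p' r s : ℕ) : Prop where
  p_pos : 0 < p
  p'_pos : 0 < p'
  abs_eq_one : |(p : ℤ) * s - p' * r| = 1
  two_mul_r_le : 2 * r ≤ p
  two_mul_s_le : 2 * s ≤ p'

theorem IsMinimal.isAdmissible {p p' r s : ℕ} (h : IsMinimal p p' r s) :
    IsAdmissible p p' r s := by
  obtain ⟨h1, h2, h3, h4, h5⟩ := h
  exact ⟨h1, h2, h3, by omega, by omega⟩

theorem IsMinimal.swap {p p' r s : ℕ} (h : IsMinimal p p' r s) : IsMinimal p' p s r :=
  ⟨h.p'_pos, h.p_pos, by rw [abs_sub_comm]; exact h.abs_eq_one, h.two_mul_s_le, h.two_mul_r_le⟩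

theorem IsMinimal.step {p p' r s : ℕ} (h : IsMinimal p p' r s) (k : ℕ) :
    IsMinimal p (p' + k * p) r (s + k * r) := by
  refine ⟨h.p_pos, by have := h.p'_pos; positivity, ?_, h.two_mul_r_le, ?_⟩
  · rw [← h.abs_eq_one]
    push_cast
    congr 1
    ring
  · nlinarith [h.two_mul_r_le, h.two_mul_s_le]

theorem realizes_replicate {w : List Move} {p p' r s : ℕ} (h : IsMinimal p p' r s)
    {S : State → Prop} (hS : ∀ σ, S σ → ∀ i, S (σ.step i))
    (hw : ∀ σ, S σ → Realizes w p p' r s σ) (k : ℕ) :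
    ∀ σ, S σ →
      Realizes (List.replicate k Move.step ++ w) p (p' + k * p) r (s + k * r) σ := by
  induction k with
  | zero => simpa using hw
  | succ k ih =>
    intro σ hσ
    rw [List.replicate_succ, List.cons_append, add_mul, add_mul, one_mul, one_mul, ← add_assoc,
      ← add_assoc]
    exact Realizes.step (h.step k).isAdmissible fun i => ih _ (hS σ hσ i)

/-- If at least one step is performed, the start may be any state that is led into `S` by a step. -/
theorem realizes_replicate_of_pos {w : List Move} {p p' r s : ℕ} (h : IsMinimal p p' r s)
    {S : State → Prop} (hS : ∀ σ, S σ → ∀ i, S (σ.step i))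
    (hw : ∀ σ, S σ → Realizes w p p' r s σ) {k : ℕ} (hk : 1 ≤ k) {σ : State}
    (hσ : ∀ i, S (σ.step i)) :
    Realizes (List.replicate k Move.step ++ w) p (p' + k * p) r (s + k * r) σ := by
  obtain ⟨k, rfl⟩ := Nat.exists_eq_add_of_le' hk
  rw [List.replicate_succ, List.cons_append, add_mul, add_mul, one_mul, one_mul, ← add_assoc,
    ← add_assoc]
  exact Realizes.step (h.step k).isAdmissible fun i =>
    realizes_replicate h hS hw k _ (hσ i)

/-- The word which performs `e 0`, …, `e n` steps, with a swap between any two groups of steps. -/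
def zoneWord : ℕ → (ℕ → ℕ) → List Move
  | 0, e => List.replicate (e 0) Move.step ++ []
  | n + 1, e =>
    List.replicate (e 0) Move.step ++ (Move.swap :: zoneWord n (fun u => e (u + 1)))

/-- The parameters are read off from the continued fraction `(e 0, …, e n + 2)`: a step replaces
`p' / p` by `p' / p + 1`, a swap replaces it by its inverse, and the initial value is `2`. -/
theorem exists_realizes (n : ℕ) (e : ℕ → ℕ) :
    ∃ p p' r s : ℕ, IsMinimal p p' r s ∧
      cfEval n (fun u => e u + if u = n then 2 else 0) = (p' : ℚ) / p ∧
      (∀ L M, Realizes (zoneWord n e) p p' r s (State.fin L M)) ∧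
      (1 ≤ e 0 → ∀ L, Realizes (zoneWord n e) p p' r s (half L)) ∧
      (1 ≤ n → 1 ≤ e 1 → ∀ M, Realizes (zoneWord n e) p p' r s (inf M)) ∧
      (1 ≤ n → 1 ≤ e 1 → 1 ≤ e 0 → Realizes (zoneWord n e) p p' r s top) := by
  induction n generalizing e with
  | zero =>
    have h0 : IsMinimal 1 2 0 1 := ⟨one_pos, two_pos, by norm_num, by norm_num, by norm_num⟩
    have hS : ∀ σ, (∃ L M, σ = State.fin L M) → ∀ i, ∃ L M, σ.step i = State.fin L M := by
      rintro _ ⟨L, M, rfl⟩ i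
      exact ⟨_, _, rfl⟩
    have hw : ∀ σ, (∃ L M, σ = State.fin L M) → Realizes [] 1 2 0 1 σ := by
      rintro _ ⟨L, M, rfl⟩
      exact realizes_nil L M
    refine ⟨_, _, _, _, h0.step (e 0), ?_, ?_, ?_, by omega, by omega⟩
    · simp [cfEval]
      ring
    · exact fun L M => realizes_replicate h0 hS hw _ _ ⟨L, M, rfl⟩
    · exact fun he L => realizes_replicate_of_pos h0 hS hw he fun i => ⟨L - i, i, rfl⟩
  | succ n ih =>
    obtain ⟨p, p', r, s, h, hcf, hfin, hhalf, -, -⟩ := ih (fun u => e (u + 1))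
    have hS : ∀ σ, (∃ L M, σ = State.fin L M) → ∀ i, ∃ L M, σ.step i = State.fin L M := by
      rintro _ ⟨L, M, rfl⟩ i
      exact ⟨_, _, rfl⟩
    have hw : ∀ σ, (∃ L M, σ = State.fin L M) →
        Realizes (Move.swap :: zoneWord n (fun u => e (u + 1))) p' p s r σ := by
      rintro _ ⟨L, M, rfl⟩
      exact Realizes.swap (swapWeight_mul_kernel_swap_fin L M) (hfin M L)
    have hS' : ∀ σ, (∃ M, σ = inf M) → ∀ i, ∃ M, σ.step i = inf M := by
      rintro _ ⟨M, rfl⟩ i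
      exact ⟨_, rfl⟩
    have hw' : 1 ≤ e 1 → ∀ σ, (∃ M, σ = inf M) →
        Realizes (Move.swap :: zoneWord n (fun u => e (u + 1))) p' p s r σ := by
      rintro he _ ⟨M, rfl⟩
      exact Realizes.swap (swapWeight_mul_kernel_swap_inf M) (hhalf he M)
    refine ⟨_, _, _, _, h.swap.step (e 0), ?_, ?_, ?_, ?_, ?_⟩
    · have hp' : (p' : ℚ) ≠ 0 := by exact_mod_cast h.p'_pos.ne'
      have hcf' : cfEval n (fun i => e (i + 1) + if i + 1 = n + 1 then 2 else 0) =
          (p' : ℚ) / p := by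
        simpa using hcf
      simp only [cfEval]
      rw [hcf', if_neg (by omega)]
      push_cast
      field_simp
      ring
    · exact fun L M => realizes_replicate h.swap hS hw _ _ ⟨L, M, rfl⟩
    · exact fun he L => realizes_replicate_of_pos h.swap hS hw he fun i => ⟨L - i, i, rfl⟩
    · exact fun _ he M => realizes_replicate h.swap hS' (hw' he) _ _ ⟨M, rfl⟩
    · exact fun _ he he0 => realizes_replicate_of_pos h.swap hS' (hw' he) he0 fun i => ⟨i, rfl⟩

/-! ### The parameters and the character -/

theorem IsMinimal.coprime {p p' r s : ℕ} (h : IsMinimal p p' r s) : Nat.Coprime p p' := by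
  rw [← Nat.isCoprime_iff_coprime]
  rcases (abs_eq zero_le_one).1 h.abs_eq_one with h1 | h1
  · exact ⟨s, -r, by linarith⟩
  · exact ⟨-s, r, by linarith⟩

theorem IsMinimal.eq_of_div_eq {P P' R S p p' : ℕ} (h : IsMinimal P P' R S)
    (hcop : Nat.Coprime p p') (hp : 0 < p) (hdiv : (p' : ℚ) / p = (P' : ℚ) / P) :
    P = p ∧ P' = p' := by
  have hP := h.p_pos
  rw [div_eq_div_iff (by positivity) (by positivity)] at hdiv
  have hmul : p' * P = P' * p := by exact_mod_cast hdiv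
  have h1 : P = p := Nat.dvd_antisymm
    (h.coprime.dvd_of_dvd_mul_left (Dvd.intro_left _ hmul))
    (hcop.dvd_of_dvd_mul_left (Dvd.intro_left _ hmul.symm))
  subst h1
  exact ⟨rfl, (Nat.eq_of_mul_eq_mul_right hP hmul).symm⟩

/-- There are two solutions of `|p s - p' r| = 1` with `0 ≤ r ≤ p` and `0 ≤ s ≤ p'`, related by
`(r, s) ↦ (p - r, p' - s)`; the least one is that with `2 r ≤ p` and `2 s ≤ p'`. -/
theorem IsMinimal.eq_of_isLeast {p p' r s r₀ s₀ : ℕ} (h : IsMinimal p p' r s) (hp : 1 < p)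
    (hrs : IsLeast {x : ℕ × ℕ | |(p : ℤ) * (x.2 : ℤ) - (p' : ℤ) * (x.1 : ℤ)| = 1} (r₀, s₀)) :
    r = r₀ ∧ s = s₀ := by
  have h0 : |(p : ℤ) * s₀ - p' * r₀| = 1 := hrs.1
  have hle : r₀ ≤ r ∧ s₀ ≤ s := hrs.2 (show (r, s) ∈ _ from h.abs_eq_one)
  have hcop : IsCoprime (p : ℤ) p' := Nat.isCoprime_iff_coprime.2 h.coprime
  have hr := h.two_mul_r_le
  have hs := h.two_mul_s_le
  have hpp : (0 : ℤ) < p := by exact_mod_cast h.p_pos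
  have hcase : (p : ℤ) * s - p' * r = p * s₀ - p' * r₀ ∨
      (p : ℤ) * s - p' * r = -(p * s₀ - p' * r₀) := by
    rcases (abs_eq zero_le_one).1 h.abs_eq_one with h1 | h1 <;>
    rcases (abs_eq zero_le_one).1 h0 with h2 | h2 <;> omega
  rcases hcase with h1 | h1
  · have hd : (p : ℤ) ∣ (r : ℤ) - r₀ :=
      hcop.dvd_of_dvd_mul_left (y := (p' : ℤ)) ⟨s - s₀, by linarith⟩
    have hr0 : (r : ℤ) - r₀ = 0 := Int.eq_zero_of_abs_lt_dvd hd (by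
      rw [abs_of_nonneg (by omega)]; omega)
    refine ⟨by omega, ?_⟩
    have : (p : ℤ) * (s - s₀) = 0 := by
      rw [show (r : ℤ) = r₀ by linarith] at h1; linarith
    rcases mul_eq_zero.1 this with h2 | h2 <;> omega
  · -- here `r + r₀ ≤ 2 * r ≤ p` is divisible by `p`, so that it is `0` or `p`
    have hd : (p : ℤ) ∣ (r : ℤ) + r₀ :=
      hcop.dvd_of_dvd_mul_left (y := (p' : ℤ)) ⟨s + s₀, by linarith⟩
    obtain ⟨k, hk⟩ := hd
    have hk2 : k < 2 := by nlinarith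
    have hk0 : 0 ≤ k := by
      by_contra hc
      nlinarith
    interval_cases k
    · exfalso
      have hr0 : r = 0 := by omega
      subst hr0
      have h2 := h.abs_eq_one
      rw [Nat.cast_zero, mul_zero, sub_zero] at h2
      have h3 : (p : ℤ) ∣ 1 := by rw [← h2]; exact (dvd_abs _ _).2 (dvd_mul_right _ _)
      have := Int.le_of_dvd one_pos h3
      omega
    · have hss : (p : ℤ) * (s + s₀ - p') = 0 := by
        have : (p' : ℤ) * (r + r₀) = p' * (p * 1) := by rw [hk]
        linarith
      rcases mul_eq_zero.1 hss with h2 | h2 <;> omega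

theorem virasoroChar_of_isBosonSum {p p' r s : ℕ} {F : PowerSeries ℤ}
    (h : IsBosonSum p p' r s top.kernel F) :
    Summable (rochaCaridiTerm p p' r s) ∧ virasoroChar p p' r s = F := by
  obtain ⟨A, B, hA, hB, rfl⟩ := h
  have h1 : HasSum (rochaCaridiTerm p p' r s) (qPochInf * (A - B)) := by
    refine ((hA.sub hB).mul_left qPochInf).congr_fun fun l => ?_
    simp only [rochaCaridiTerm, kernel, exponent₁, exponent₂]
    linear_combination (X ^ ((l * p + r) * (l * p' + s)).toNat -
      X ^ (l ^ 2 * (p * p') + l * (p' * r - p * s)).toNat) * qPochInf_mul_qInv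
  refine ⟨h1.summable, ?_⟩
  rw [virasoroChar, h1.tsum_eq]
  linear_combination (A - B) * qPochInf_mul_qInv

/-! ### Sequences of partitions as paths -/

/-- The list of the entries `x 1, …, x k`. -/
def entries (k : ℕ) (x : ℕ → ℕ) : List ℕ := (List.range k).map fun i => x (i + 1)

/-- The list of all parts of the partitions `lam 0, …, lam n`. -/
def flatten : ℕ → (ℕ → ℕ) → (ℕ → ℕ → ℕ) → List ℕ
  | 0, e, lam => entries (e 0) (lam 0) ++ []
  | n + 1, e, lam =>
    entries (e 0) (lam 0) ++ flatten n (fun u => e (u + 1)) (fun u => lam (u + 1))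

theorem length_entries (k : ℕ) (x : ℕ → ℕ) : (entries k x).length = k := by
  simp [entries]

theorem entries_inj {k : ℕ} {x y : ℕ → ℕ} (h : entries k x = entries k y) {i : ℕ} (hi : i < k) :
    x (i + 1) = y (i + 1) :=
  List.map_inj_left.1 h i (List.mem_range.2 hi)

theorem flatten_inj {n : ℕ} {e : ℕ → ℕ} {lam lam' : ℕ → ℕ → ℕ}
    (h : flatten n e lam = flatten n e lam') {u i : ℕ} (hu : u ≤ n) (hi : i < e u) :
    lam u (i + 1) = lam' u (i + 1) := by
  induction n generalizing e lam lam' u with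
  | zero =>
    obtain rfl : u = 0 := by omega
    exact entries_inj (List.append_inj_left h (by simp [length_entries])) hi
  | succ n ih =>
    have h1 := List.append_inj h (by simp [length_entries])
    cases u with
    | zero => exact entries_inj h1.1 hi
    | succ u => exact ih h1.2 (by omega) hi

theorem exists_entries_append {k : ℕ} {w : List Move} {σ : State} {l : List ℕ}
    (h : pathWeight (List.replicate k Move.step ++ w) σ l ≠ 0) :
    ∃ (x : ℕ → ℕ) (y : List ℕ) (σ' : State), (∀ i, ¬ (1 ≤ i ∧ i ≤ k) → x i = 0) ∧
      l = entries k x ++ y ∧ pathWeight w σ' y ≠ 0 := by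
  induction k generalizing σ l with
  | zero => exact ⟨fun _ => 0, l, σ, fun _ _ => rfl, rfl, h⟩
  | succ k ih =>
    rw [List.replicate_succ, List.cons_append] at h
    cases l with
    | nil => exact absurd rfl h
    | cons i l =>
      obtain ⟨x, y, σ', hx, rfl, hy⟩ := ih (right_ne_zero_of_mul h)
      refine ⟨fun j => if j = 0 then 0 else if j = 1 then i else x (j - 1), y, σ', ?_, ?_, hy⟩
      · intro j hj
        dsimp only
        split_ifs with h1 h2
        · rfl
        · omega
        · exact hx _ (by omega)
      · unfold entries
        rw [List.range_succ_eq_map, List.map_cons, List.map_map, List.cons_append]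
        rfl

/-- Paths whose number of steps does not fit the word contribute nothing; all others come from a
sequence of the right shape. -/
theorem exists_flatten {n : ℕ} {e : ℕ → ℕ} {σ : State} {l : List ℕ}
    (h : pathWeight (zoneWord n e) σ l ≠ 0) :
    ∃ lam : ℕ → ℕ → ℕ, (∀ u i, ¬ (u ≤ n ∧ 1 ≤ i ∧ i ≤ e u) → lam u i = 0) ∧
      flatten n e lam = l := by
  induction n generalizing e σ l with
  | zero =>
    obtain ⟨x, y, σ', hx, rfl, hy⟩ := exists_entries_append h
    refine ⟨fun u i => if u = 0 then x i else 0, ?_, ?_⟩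
    · intro u i hui
      dsimp only
      split_ifs with hu
      · subst hu
        exact hx i (by omega)
      · rfl
    · cases y with
      | nil => rfl
      | cons => exact absurd rfl hy
  | succ n ih =>
    obtain ⟨x, y, σ', hx, rfl, hy⟩ := exists_entries_append h
    have hy' : pathWeight (zoneWord n fun u => e (u + 1)) σ'.swap y ≠ 0 := by
      cases y <;> exact right_ne_zero_of_mul hy
    obtain ⟨lam, hlam, rfl⟩ := ih hy'
    refine ⟨fun u i => Nat.casesOn u (x i) (fun v => lam v i), ?_, rfl⟩
    rintro (_ | u) i hui
    · exact hx i (by omega)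
    · exact hlam u i (by omega)

theorem pathWeight_entries_append {w : List Move} {y : List ℕ} {x : ℕ → ℕ} {st : ℕ → State}
    (hst : ∀ i, st (i + 1) = (st i).step (x (i + 1))) (k : ℕ) :
    pathWeight (List.replicate k Move.step ++ w) (st 0) (entries k x ++ y) =
      (∏ i ∈ range k, (st i).weight (x (i + 1))) * pathWeight w (st k) y := by
  induction k generalizing w y with
  | zero => simp [entries]
  | succ k ih =>
    rw [List.replicate_succ', List.append_assoc, List.singleton_append, entries, List.range_succ,
      List.map_append, List.append_assoc, List.map_singleton, List.singleton_append]
    refine ih.trans ?_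
    rw [prod_range_succ, mul_assoc, hst k]
    rfl

/-- The contribution of the path with given steps, in terms of the states `st u i` reached after `i`
steps in the zone `u`. -/
theorem pathWeight_flatten {n : ℕ} {e : ℕ → ℕ} {lam : ℕ → ℕ → ℕ} {st : ℕ → ℕ → State}
    (hstep : ∀ u i, st u (i + 1) = (st u i).step (lam u (i + 1)))
    (hswap : ∀ u < n, st (u + 1) 0 = (st u (e u)).swap) :
    pathWeight (zoneWord n e) (st 0 0) (flatten n e lam) =
      (∏ u ∈ range (n + 1), ∏ i ∈ range (e u), (st u i).weight (lam u (i + 1))) *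
      (∏ u ∈ range n, (st u (e u)).swapWeight) * finalWeight (st n (e n)) := by
  induction n generalizing e lam st with
  | zero =>
    refine (pathWeight_entries_append (hstep 0) _).trans ?_
    simp [pathWeight]
  | succ n ih =>
    refine (pathWeight_entries_append (hstep 0) _).trans ?_
    have h1 := ih (e := fun u => e (u + 1)) (lam := fun u => lam (u + 1))
      (st := fun u => st (u + 1)) (fun u => hstep (u + 1)) fun u hu => hswap (u + 1) (by omega)
    rw [prod_range_succ' _ (n + 1), prod_range_succ' (fun u => (st u (e u)).swapWeight) n]
    have h2 : ∀ (w : List Move) (σ : State) (y : List ℕ),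
        pathWeight (Move.swap :: w) σ y = σ.swapWeight * pathWeight w σ.swap y := by
      intro w σ y
      cases y <;> rfl
    rw [h2, ← hswap 0 (by omega), h1]
    ring

/-- The state reached by the path of `lam` after `i` steps in the zone `u`. The subtractions are
truncated; this does not matter where the weights do not vanish. -/
def zoneState (e : ℕ → ℕ) (lam : ℕ → ℕ → ℕ) : ℕ → ℕ → State
  | 0, 0 => top
  | 0, i + 1 => inf (lam 0 (i + 1))
  | 1, 0 => half (zoneBound e lam 1)
  | 1, i + 1 => State.fin (zoneBound e lam 1 - ∑ j ∈ Icc 1 (i + 1), lam 1 j) (lam 1 (i + 1))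
  | u + 2, i => State.fin (zoneBound e lam (u + 2) - ∑ j ∈ Icc 1 i, lam (u + 2) j)
      (if i = 0 then zoneBound e lam (u + 1) - zoneWt e lam (u + 1) else lam (u + 2) i)

theorem zoneState_succ (e : ℕ → ℕ) (lam : ℕ → ℕ → ℕ) (u i : ℕ) :
    zoneState e lam u (i + 1) = (zoneState e lam u i).step (lam u (i + 1)) := by
  match u, i with
  | 0, 0 => rfl
  | 0, i + 1 => rfl
  | 1, 0 => simp [zoneState, step]
  | 1, i + 1 =>
    simp only [zoneState, step]
    rw [sum_Icc_succ_top (by omega) (fun j => lam 1 j), Nat.sub_sub]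
  | u + 2, i =>
    simp only [zoneState, step]
    rw [sum_Icc_succ_top (by omega), Nat.sub_sub, if_neg (by omega)]

theorem zoneState_swap {e : ℕ → ℕ} (lam : ℕ → ℕ → ℕ) {u : ℕ} (hu : 1 ≤ e u) :
    zoneState e lam (u + 1) 0 = (zoneState e lam u (e u)).swap := by
  obtain ⟨k, hk⟩ := Nat.exists_eq_add_of_le' hu
  match u with
  | 0 => rw [hk]; simp [zoneState, swap, zoneBound, hk]
  | 1 => rw [hk]; simp [zoneState, swap, zoneBound, zoneWt, hk]
  | u + 2 => simp [zoneState, swap, zoneBound, zoneWt, hk]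

theorem finalWeight_zoneState {e : ℕ → ℕ} (lam : ℕ → ℕ → ℕ) {n : ℕ} (hn : 1 ≤ n)
    (he : 1 ≤ e 1) :
    finalWeight (zoneState e lam n (e n)) =
      if zoneBound e lam n - zoneWt e lam n = 0 then 1 else 0 := by
  have h : ∀ L M, finalWeight (State.fin L M) = if L = 0 then 1 else 0 := by
    intro L M
    cases L <;> simp [finalWeight]
  obtain ⟨k, hk⟩ := Nat.exists_eq_add_of_le' he
  match n with
  | 0 => omega
  | 1 =>
    rw [hk]
    simp only [zoneState, h, zoneWt, hk]
  | n + 2 => exact h _ _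

/-- The path of a sequence of partitions contributes nothing unless the sequence is fermionic. -/
theorem isFermionic_of_weight_ne_zero {n : ℕ} {e : ℕ → ℕ} {lam : ℕ → ℕ → ℕ} (hn : 1 ≤ n)
    (he : 1 ≤ e 1) (hsupp : ∀ u i, ¬ (u ≤ n ∧ 1 ≤ i ∧ i ≤ e u) → lam u i = 0)
    (hw : ∀ u ≤ n, ∀ i < e u, (zoneState e lam u i).weight (lam u (i + 1)) ≠ 0)
    (hf : finalWeight (zoneState e lam n (e n)) ≠ 0) : IsFermionic n e lam := by
  have hL : ∀ u ≤ n, 0 < u → ∀ i < e u,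
      lam u (i + 1) ≤ zoneBound e lam u - ∑ j ∈ Icc 1 i, lam u j := by
    intro u hu hu0 i hi
    have h := hw u hu i hi
    match u, i with
    | 0, _ => omega
    | 1, 0 =>
      simp only [zoneState, weight] at h
      simpa using (ite_ne_right_iff.1 h).1
    | 1, i + 1 =>
      simp only [zoneState, weight] at h
      exact (ite_ne_right_iff.1 h).1.1
    | u + 2, i =>
      simp only [zoneState, weight] at h
      exact (ite_ne_right_iff.1 h).1.1
  have hwt : ∀ u ≤ n, 0 < u → zoneWt e lam u ≤ zoneBound e lam u := by
    intro u hu hu0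
    have : ∀ i ≤ e u, ∑ j ∈ Icc 1 i, lam u j ≤ zoneBound e lam u := by
      intro i
      induction i with
      | zero => simp
      | succ i ih =>
        intro hi
        have h1 := ih (by omega)
        have h2 := hL u hu hu0 i (by omega)
        rw [sum_Icc_succ_top (by omega)]
        omega
    exact this _ le_rfl
  refine ⟨hsupp, ?_, ?_, hwt, ?_⟩
  · intro u hu i hi hie
    have h := hw u hu i (by omega)
    obtain ⟨i, rfl⟩ := Nat.exists_eq_add_of_le' hi
    match u with
    | 0 =>
      simp only [zoneState, weight] at h
      exact (ite_ne_right_iff.1 h).1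
    | 1 =>
      simp only [zoneState, weight] at h
      exact (ite_ne_right_iff.1 h).1.2
    | u + 2 =>
      simp only [zoneState, weight] at h
      simpa using (ite_ne_right_iff.1 h).1.2
  · intro u hu hu1
    obtain ⟨u, rfl⟩ : ∃ v, u = v + 2 := ⟨u - 2, by omega⟩
    have h1 := hwt (u + 1) (by omega) (by omega)
    change (lam (u + 2) 1 : ℤ) ≤ zoneBound e lam (u + 1) - zoneWt e lam (u + 1)
    rcases Nat.eq_zero_or_pos (e (u + 2)) with h0 | h0
    · rw [hsupp (u + 2) 1 (by omega)]
      omega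
    · have h := hw (u + 2) hu 0 h0
      simp only [zoneState, weight] at h
      have h2 := (ite_ne_right_iff.1 h).1.2
      simp only [if_true, zero_add] at h2
      omega
  · rw [finalWeight_zoneState lam hn he] at hf
    have h1 := (ite_ne_right_iff.1 hf).1
    have h2 := hwt n le_rfl (by omega)
    omega

theorem prod_Icc_one {R : Type*} [CommMonoid R] (g : ℕ → R) (k : ℕ) :
    ∏ i ∈ Icc 1 k, g i = ∏ i ∈ range k, g (i + 1) := by
  induction k with
  | zero => simp
  | succ k ih => rw [prod_Icc_succ_top (by omega), ih, prod_range_succ]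

theorem prod_Icc_two {R : Type*} [CommMonoid R] (g : ℕ → R) (k : ℕ) :
    ∏ i ∈ Icc 2 k, g i = ∏ i ∈ range k, if i = 0 then 1 else g (i + 1) := by
  induction k with
  | zero => simp
  | succ k ih =>
    rw [prod_range_succ, ← ih]
    rcases Nat.eq_zero_or_pos k with rfl | hk
    · simp
    · rw [prod_Icc_succ_top (by omega), if_neg (by omega)]

theorem weight_zoneState_zero {n : ℕ} {e : ℕ → ℕ} {lam : ℕ → ℕ → ℕ} (h : IsFermionic n e lam)
    {i : ℕ} (hi : i < e 0) :
    (zoneState e lam 0 i).weight (lam 0 (i + 1)) = X ^ lam 0 (i + 1) ^ 2 *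
      if i = 0 then 1 else qInv (qPoch (lam 0 (i + 1 - 1) - lam 0 (i + 1))) := by
  cases i with
  | zero => simp [zoneState, weight]
  | succ i =>
    simp only [zoneState, weight]
    rw [if_pos (h.antitone 0 (Nat.zero_le n) (i + 1) (by omega) (by omega)), if_neg (by omega)]
    rfl

theorem weight_zoneState_pos {n : ℕ} {e : ℕ → ℕ} {lam : ℕ → ℕ → ℕ} (h : IsFermionic n e lam)
    {u i : ℕ} (hu : u ≤ n) (hu0 : 0 < u) (hi : i < e u) :
    (zoneState e lam u i).weight (lam u (i + 1)) = X ^ lam u (i + 1) ^ 2 *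
      if u = 1 ∧ i = 0 then 1 else gaussPoly
        (2 * ((zoneBound e lam u : ℤ) - ∑ j ∈ Icc 1 (i + 1), zonePart e lam u j)
          + zonePart e lam u (i + 1 - 1) + zonePart e lam u (i + 1))
        (zonePart e lam u (i + 1 - 1) - zonePart e lam u (i + 1)) := by
  have hwt := h.wt_le u hu hu0
  have hsum : ∑ j ∈ Icc 1 (i + 1), lam u j ≤ zoneWt e lam u :=
    sum_le_sum_of_subset (Icc_subset_Icc_right hi)
  have hsumZ : ∑ j ∈ Icc 1 (i + 1), zonePart e lam u j = ∑ j ∈ Icc 1 (i + 1), (lam u j : ℤ) := by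
    refine sum_congr rfl fun j hj => ?_
    rw [mem_Icc] at hj
    rw [zonePart, if_neg (by omega)]
  rw [hsumZ]
  rw [sum_Icc_succ_top (by omega)] at hsum ⊢
  have hS : ((zoneBound e lam u - ∑ j ∈ Icc 1 i, lam u j : ℕ) : ℤ) =
      zoneBound e lam u - ∑ j ∈ Icc 1 i, (lam u j : ℤ) := by
    rw [Nat.cast_sub (by omega)]
    push_cast
    rfl
  have hpart : zonePart e lam u (i + 1) = lam u (i + 1) := by
    rw [zonePart, if_neg (by omega)]
  rw [hpart, Nat.add_sub_cancel]
  have hle : 0 < i → lam u (i + 1) ≤ lam u i := fun h0 => h.antitone u hu i h0 hi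
  match u, i with
  | 0, _ => omega
  | 1, 0 =>
    simp only [zoneState, weight]
    rw [if_pos (by simpa using hsum.trans hwt)]
    simp
  | 1, i + 1 =>
    simp only [zoneState, weight]
    rw [if_pos ⟨by omega, hle (by omega)⟩, if_neg (by omega), hS, zonePart, if_neg (by omega)]
    congr 2
    ring
  | u + 2, i =>
    simp only [zoneState, weight]
    have hM : ((if i = 0 then zoneBound e lam (u + 1) - zoneWt e lam (u + 1)
        else lam (u + 2) i : ℕ) : ℤ) = zonePart e lam (u + 2) i := by
      unfold zonePart
      have := h.wt_le (u + 1) (by omega) (by omega)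
      split_ifs
      · simp only [Nat.add_succ_sub_one]
        omega
      · rfl
    have hle' : (lam (u + 2) (i + 1) : ℤ) ≤ zonePart e lam (u + 2) i := by
      rcases Nat.eq_zero_or_pos i with rfl | h0
      · have := h.first_le (u + 2) hu (by omega)
        rw [zonePart, if_neg one_ne_zero] at this
        exact this
      · rw [zonePart, if_neg (by omega)]
        exact_mod_cast hle h0
    have hcond : lam (u + 2) (i + 1) ≤ zoneBound e lam (u + 2) - ∑ j ∈ Icc 1 i, lam (u + 2) j ∧
        lam (u + 2) (i + 1) ≤
          if i = 0 then zoneBound e lam (u + 1) - zoneWt e lam (u + 1) else lam (u + 2) i := by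
      rw [← hM] at hle'
      exact ⟨by omega, by exact_mod_cast hle'⟩
    rw [if_pos hcond, hM, hS, if_neg (by omega)]
    congr 2
    ring

theorem pathWeight_flatten_eq {n : ℕ} {e : ℕ → ℕ} {lam : ℕ → ℕ → ℕ} (hn : 1 ≤ n)
    (he : ∀ u < n, 1 ≤ e u) (he1 : 1 ≤ e 1) (h : IsFermionic n e lam) :
    pathWeight (zoneWord n e) top (flatten n e lam) = fermionicTerm n e lam := by
  have h1 := pathWeight_flatten (n := n) (e := e) (zoneState_succ e lam)
    fun u hu => zoneState_swap lam (he u hu)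
  refine h1.trans ?_
  rw [finalWeight_zoneState lam hn he1, if_pos (by rw [h.wt_last, Nat.sub_self]), mul_one]
  have hsw : ∏ u ∈ range n, (zoneState e lam u (e u)).swapWeight =
      qInv (qPoch (2 * lam 0 (e 0))) := by
    obtain ⟨m, rfl⟩ := Nat.exists_eq_add_of_le' hn
    rw [prod_range_succ', prod_eq_one, one_mul]
    · obtain ⟨k, hk⟩ := Nat.exists_eq_add_of_le' (he 0 (by omega))
      rw [hk]
      rfl
    · intro u hu
      rw [mem_range] at hu
      obtain ⟨k, hk⟩ := Nat.exists_eq_add_of_le' (he (u + 1) (by omega))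
      rw [hk]
      cases u <;> rfl
  have hzero : ∏ i ∈ range (e 0), (zoneState e lam 0 i).weight (lam 0 (i + 1)) =
      (∏ i ∈ range (e 0), X ^ lam 0 (i + 1) ^ 2) *
        ∏ i ∈ Icc 2 (e 0), qInv (qPoch (lam 0 (i - 1) - lam 0 i)) := by
    rw [prod_Icc_two, ← prod_mul_distrib]
    exact prod_congr rfl fun i hi => weight_zoneState_zero h (mem_range.1 hi)
  have hpos : ∀ u ∈ range n,
      ∏ i ∈ range (e (u + 1)), (zoneState e lam (u + 1) i).weight (lam (u + 1) (i + 1)) =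
      (∏ i ∈ range (e (u + 1)), X ^ lam (u + 1) (i + 1) ^ 2) *
        ∏ i ∈ Icc (if u + 1 = 1 then 2 else 1) (e (u + 1)), gaussPoly
          (2 * ((zoneBound e lam (u + 1) : ℤ) - ∑ j ∈ Icc 1 i, zonePart e lam (u + 1) j)
            + zonePart e lam (u + 1) (i - 1) + zonePart e lam (u + 1) i)
          (zonePart e lam (u + 1) (i - 1) - zonePart e lam (u + 1) i) := by
    intro u hu
    rw [mem_range] at hu
    rw [prod_congr rfl fun i hi =>
      weight_zoneState_pos h (u := u + 1) (by omega) (by omega) (mem_range.1 hi), prod_mul_distrib]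
    congr 1
    by_cases hu1 : u + 1 = 1
    · rw [if_pos hu1, prod_Icc_two]
      simp only [hu1, true_and]
    · rw [if_neg hu1, prod_Icc_one]
      simp only [hu1, false_and, if_false]
  have hX : (X : PowerSeries ℤ) ^ (∑ u ∈ range (n + 1), ∑ i ∈ Icc 1 (e u), lam u i ^ 2) =
      (∏ u ∈ range n, ∏ i ∈ range (e (u + 1)), X ^ lam (u + 1) (i + 1) ^ 2) *
        ∏ i ∈ range (e 0), X ^ lam 0 (i + 1) ^ 2 := by
    rw [← prod_pow_eq_pow_sum]
    simp only [← prod_pow_eq_pow_sum, prod_Icc_one]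
    rw [prod_range_succ']
  rw [hsw, prod_range_succ', hzero, prod_congr rfl hpos, prod_mul_distrib, fermionicTerm, hX,
    prod_Icc_one (fun u => ∏ i ∈ Icc (if u = 1 then 2 else 1) (e u), gaussPoly
      (2 * ((zoneBound e lam u : ℤ) - ∑ j ∈ Icc 1 i, zonePart e lam u j)
        + zonePart e lam u (i - 1) + zonePart e lam u i)
      (zonePart e lam u (i - 1) - zonePart e lam u i))]
  ring

theorem hasSum_fermionicTerm {n : ℕ} {e : ℕ → ℕ} (hn : 1 ≤ n) (he : ∀ u < n, 1 ≤ e u)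
    (he1 : 1 ≤ e 1) {F : PowerSeries ℤ} (hF : HasSum (pathWeight (zoneWord n e) top) F) :
    HasSum (fun lam : {lam : ℕ → ℕ → ℕ // IsFermionic n e lam} => fermionicTerm n e lam) F := by
  have hinj : Function.Injective
      (fun lam : {lam : ℕ → ℕ → ℕ // IsFermionic n e lam} => flatten n e lam) := by
    rintro ⟨lam, h⟩ ⟨lam', h'⟩ heq
    ext u i
    by_cases hui : u ≤ n ∧ 1 ≤ i ∧ i ≤ e u
    · obtain ⟨i, rfl⟩ := Nat.exists_eq_add_of_le' hui.2.1
      exact flatten_inj heq hui.1 hui.2.2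
    · exact (h.support u i hui).trans (h'.support u i hui).symm
  refine ((hinj.hasSum_iff ?_).2 hF).congr_fun fun lam => ?_
  · intro l hl
    by_contra hne
    obtain ⟨lam, hsupp, rfl⟩ := exists_flatten hne
    rw [show top = zoneState e lam 0 0 from rfl, pathWeight_flatten (zoneState_succ e lam)
      fun u hu => zoneState_swap lam (he u hu)] at hne
    refine hl ⟨⟨lam, isFermionic_of_weight_ne_zero hn he1 hsupp ?_ (right_ne_zero_of_mul hne)⟩, rfl⟩
    intro u hu i hi
    have h1 := left_ne_zero_of_mul (left_ne_zero_of_mul hne)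
    exact prod_ne_zero_iff.1 (prod_ne_zero_iff.1 h1 u (mem_range.2 (by omega))) i
      (mem_range.2 hi)
  · exact (pathWeight_flatten_eq hn he he1 lam.2).symm

theorem cfEval_nonneg (n : ℕ) (c : ℕ → ℕ) : 0 ≤ cfEval n c := by
  induction n generalizing c with
  | zero => simp [cfEval]
  | succ n ih =>
    simp only [cfEval]
    have := ih fun i => c (i + 1)
    positivity

theorem one_le_cfEval {n : ℕ} {c : ℕ → ℕ} (h : 1 ≤ c 0) : 1 ≤ cfEval n c := by
  have h' : (1 : ℚ) ≤ c 0 := by exact_mod_cast h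
  cases n with
  | zero => simpa [cfEval] using h
  | succ n =>
    simp only [cfEval]
    have := cfEval_nonneg n fun i => c (i + 1)
    have : 0 ≤ 1 / cfEval n fun i => c (i + 1) := by positivity
    linarith

/-- The continued fraction of `p' / p > 1` with `p > 2` has at least two entries, and the first
two zones are not empty. -/
theorem zones_nonempty {p p' : ℕ} (hcop : Nat.Coprime p p') (hp : 2 < p) (hpp' : p < p')
    {n : ℕ} {e : ℕ → ℕ}
    (he : IsContinuedFraction ((p' : ℚ) / (p : ℚ)) n (fun u => e u + if u = n then 2 else 0)) :
    1 ≤ n ∧ (∀ u < n, 1 ≤ e u) ∧ 1 ≤ e 1 := by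
  have hp0 : (0 : ℚ) < p := by exact_mod_cast (by omega : 0 < p)
  have hval := he.value
  have hn : 1 ≤ n := by
    by_contra hn
    obtain rfl : n = 0 := by omega
    simp only [cfEval, if_true] at hval
    rw [eq_div_iff hp0.ne'] at hval
    have h1 : (e 0 + 2) * p = p' := by exact_mod_cast hval
    have h2 : p ∣ 1 := by
      rw [← hcop.gcd_eq_one]
      exact Nat.dvd_gcd dvd_rfl ⟨e 0 + 2, by rw [← h1, mul_comm]⟩
    have := Nat.le_of_dvd one_pos h2
    omega
  obtain ⟨m, rfl⟩ := Nat.exists_eq_add_of_le' hn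
  have hmid : ∀ u, 0 < u → u < m + 1 → 1 ≤ e u := by
    intro u hu hum
    have := he.one_le u hu hum
    simpa [hum.ne] using this
  have hc1 : 1 ≤ e 1 + if 1 = m + 1 then 2 else 0 := by
    split_ifs with h
    · omega
    · have := hmid 1 one_pos (by omega)
      omega
  refine ⟨hn, ?_, ?_⟩
  · intro u hu
    rcases Nat.eq_zero_or_pos u with rfl | hu0
    · -- otherwise the value of the continued fraction is at most `1`
      by_contra hc
      have h0 : e 0 = 0 := by omega
      simp only [cfEval] at hval
      rw [if_neg (by omega), h0] at hval
      have h1 : (1 : ℚ) ≤ cfEval m fun i => e (i + 1) + if i + 1 = m + 1 then 2 else 0 :=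
        one_le_cfEval (by simpa using hc1)
      have h2 : 1 / cfEval m (fun i => e (i + 1) + if i + 1 = m + 1 then 2 else 0) ≤ 1 :=
        (div_le_one (by linarith)).2 h1
      have h3 : (1 : ℚ) < p' / p := (one_lt_div hp0).2 (by exact_mod_cast hpp')
      rw [show ((0 + 0 : ℕ) : ℚ) = 0 by norm_num] at hval
      linarith
    · exact hmid u hu0 hu
  · rcases Nat.eq_zero_or_pos m with rfl | hm
    · -- otherwise `p' / p = e 0 + 1 / 2`, so that `p = 2`
      by_contra hc
      have h0 : e 1 = 0 := by omega
      simp only [cfEval] at hval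
      norm_num [h0] at hval
      have h1 : (2 * e 0 + 1) * p = 2 * p' := by
        field_simp at hval
        have h2 : ((2 * e 0 + 1 : ℕ) : ℚ) * p = ((2 * p' : ℕ) : ℚ) := by
          push_cast
          linarith
        exact_mod_cast h2
      have h2 : p ∣ 2 := hcop.dvd_of_dvd_mul_right (Dvd.intro_left _ h1)
      have := Nat.le_of_dvd two_pos h2
      omega
    · exact hmid 1 one_pos (by omega)

end BurgeTree
end

theorem mainTheorem3 (p p' : ℕ) (hcop : Nat.Coprime p p') (hp : 2 < p) (hpp' : p < p')
    (r₀ s₀ : ℕ)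
    (hrs : IsLeast {x : ℕ × ℕ | |(p : ℤ) * (x.2 : ℤ) - (p' : ℤ) * (x.1 : ℤ)| = 1} (r₀, s₀))
    (n : ℕ) (e : ℕ → ℕ)
    (he : IsContinuedFraction ((p' : ℚ) / (p : ℚ)) n
      (fun u => e u + if u = n then 2 else 0)) :
    Summable (rochaCaridiTerm p p' r₀ s₀) ∧
    HasSum (fun lam : {lam : ℕ → ℕ → ℕ // IsFermionic n e lam} => fermionicTerm n e lam)
      (virasoroChar p p' r₀ s₀) := by
  obtain ⟨hn, he0, he1⟩ := BurgeTree.zones_nonempty hcop hp hpp' he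
  obtain ⟨P, P', R, S, hmin, hcf, -, -, -, htop⟩ := BurgeTree.exists_realizes n e
  obtain ⟨F, hF, hB⟩ := htop hn he1 (he0 0 hn)
  obtain ⟨rfl, rfl⟩ := hmin.eq_of_div_eq hcop (by omega) (he.value.symm.trans hcf)
  obtain ⟨rfl, rfl⟩ := hmin.eq_of_isLeast (by omega) hrs
  obtain ⟨hsum, hchar⟩ := BurgeTree.virasoroChar_of_isBosonSum hB
  exact ⟨hsum, hchar ▸ BurgeTree.hasSum_fermionicTerm hn he0 he1 hF⟩
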